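/- Consider the delay differential equation $$x''(t)+p(t)\,x(t-\tau(t))=0,\qquad (1)$$ where $p:\mathbb R\to\mathbb R$ and $\tau:\mathbb R\to[0,\infty)$ are Lebesgue measurable and essentially bounded. For $s\in\mathbb R$ put $\tau_m:=\operatorname{ess\,sup}_{t\ge s}\tau(t)$. A solution of (1) with initial time $s$ is a function $x:[s-\tau_m,\infty)\to\mathbb R$ which is locally absolutely continuous together with its first derivative and satisfies (1) for almost every $t\ge s$. A function is oscillatory if it has arbitrarily large zeros. For $\Delta\ge 0$ let $r_\Delta$ be the solution of $r_\Delta''(t)+r_\Delta(t-\Delta)=0$ for $t\ge0$, with $r_\Delta(t)=1$ for $t\le 0$ and $r_\Delta'(0)=0$, and let $\vartheta_\Delta$ be its first positive zero. For $\rho>0$ define $\beta_0\equiv1$ and inductively, for $n\ge0$, with $$F_n(v):=\max\{\beta_n(v),\ \rho\, r_\Delta(\vartheta_\Delta-v-\Delta)\,\chi_{[-\Delta,0]}(v)\},$$ let $\varpi_n>0$ be the unique number with $\int_{-\varpi_n}^0\int_{-\varpi_n}^{u}F_n(w)\,dw\,du=1$, and let $\beta_{n+1}(t)=1$ for $t\le-\varpi_n$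 and $\beta_{n+1}(t)=1-\int_{-\varpi_n}^t\int_{-\varpi_n}^{u}F_n(v)\,dv\,du$ for $t\in[-\varpi_n,0]$. Put $\Psi(\rho,\Delta):=\lim_{n\to\infty}\varpi_n$. There is exactly one $\gamma\in[\sqrt2,\pi/2]$ with $\Psi(1,\gamma)=\gamma$. With this $\gamma$, the following holds. Assume that $p(t)\le0$ for all $t\in\mathbb R$, that $\int_0^\infty|p(t)|\,dt=\infty$, and that, for a given $s\in\mathbb R$, $\tau_m\sqrt{\operatorname{ess\,sup}_{t\in\mathbb R}|p(t)|}<\gamma$. Then every solution $x$ of (1) with initial time $s$ has exactly one of the following asymptotic behaviours: (i) $x$ is oscillatory and $\lim_{t\to\infty}x(t)=0$; (ii) $x$ is nonoscillatory, is monotone on some half-line $[T,\infty)$, and $\lim_{t\to\infty}x(t)=\lim_{t\to\infty}x'(t)=0$; (iii) $\lim_{t\to\infty}x(t)=\lim_{t\to\infty}x'(t)=+\infty$; (iv) $\lim_{t\to\infty}x(t)=\lim_{t\to\infty}x'(t)=-\infty$. If furthermore $\tau_m\sqrt{\operatorname{ess\,sup}_{t\in\mathbb R}|p(t)|}\le \frac2e$,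 then there exists a solution of (1) with initial time $s$ exhibiting (ii). -/

import Mathlib

open Set Filter Topology MeasureTheory
open scoped Nat

noncomputable section

/-! ### The delay equation `x''(t) + p(t) x(t - τ(t)) = 0` -/

/-- The maximal delay `τ_m = ess sup {τ(t) : t ≥ s}` after time `s`. -/
def maxDelay (τ : ℝ → ℝ) (s : ℝ) : ℝ :=
  essSup τ (volume.restrict (Ici s))

/-- `x` is a solution, with initial time `s`, of `x''(t) + p(t) x(t - τ(t)) = 0`: on
`[s - τ_m, ∞)` it is (locally) absolutely continuous together with its first derivative, and the
equation holds for almost every `t ≥ s`. Only the values of `x` on `[s - τ_m, ∞)` matter; the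
derivative at the left end point is the one-sided one. -/
structure IsDelaySolution (p τ : ℝ → ℝ) (s : ℝ) (x : ℝ → ℝ) : Prop where
  differentiableOn : DifferentiableOn ℝ x (Ici (s - maxDelay τ s))
  absCont : ∀ b, s - maxDelay τ s ≤ b →
    AbsolutelyContinuousOnInterval x (s - maxDelay τ s) b
  absCont_deriv : ∀ b, s - maxDelay τ s ≤ b →
    AbsolutelyContinuousOnInterval (derivWithin x (Ici (s - maxDelay τ s)))
      (s - maxDelay τ s) b
  equation : ∀ᵐ t ∂(volume.restrict (Ici s)),
    HasDerivAt (deriv x) (-(p t * x (t - τ t))) t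

/-- A function is oscillatory if it has arbitrarily large zeros. -/
def Oscillatory (x : ℝ → ℝ) : Prop :=
  ∀ T : ℝ, ∃ t, T ≤ t ∧ x t = 0

/-- Names of the four asymptotic behaviours. -/
inductive AsymptoticBehavior
  | oscillatoryDecay
  | monotoneDecay
  | toPosInfinity
  | toNegInfinity

/-- The meaning of the four asymptotic behaviours. -/
def AsymptoticBehavior.Holds : AsymptoticBehavior → (ℝ → ℝ) → Prop
  | .oscillatoryDecay, x => Oscillatory x ∧ Tendsto x atTop (𝓝 0)
  | .monotoneDecay, x => ¬ Oscillatory x ∧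
      (∃ T : ℝ, MonotoneOn x (Ici T) ∨ AntitoneOn x (Ici T)) ∧
      Tendsto x atTop (𝓝 0) ∧ Tendsto (deriv x) atTop (𝓝 0)
  | .toPosInfinity, x => Tendsto x atTop atTop ∧ Tendsto (deriv x) atTop atTop
  | .toNegInfinity, x => Tendsto x atTop atBot ∧ Tendsto (deriv x) atTop atBot

/-! ### The comparison function `r_Δ` and its first zero -/

/-- The solution `r_Δ` of `r''(t) + r(t - Δ) = 0` for `t ≥ 0` with `r = 1` on `(-∞, 0]` and
`r'(0) = 0`, written as its series
`r_Δ(t) = 1 + ∑_{k ≥ 1} (-1)^k / (2k)! * ((t - (k-1)Δ)⁺)^(2k)`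
(for `Δ = 0` and `t ≥ 0` it is `cos t`). See `descent_isSolution`. -/
def descent (Δ t : ℝ) : ℝ :=
  1 + ∑' k : ℕ, (-1 : ℝ) ^ (k + 1) / ((2 * k + 2)! : ℝ) * (max (t - k * Δ) 0) ^ (2 * k + 2)

theorem hasDerivAt_max_pow (c : ℝ) (m : ℕ) (hm : 1 ≤ m) (t : ℝ) :
    HasDerivAt (fun t : ℝ => (max (t - c) 0) ^ (m + 1)) ((m + 1 : ℝ) * (max (t - c) 0) ^ m) t := by
  have hlin : ∀ t, HasDerivAt (fun t : ℝ => t - c) 1 t := fun t => (hasDerivAt_id t).sub_const c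
  rcases lt_trichotomy t c with h | h | h
  · have h1 : (fun t : ℝ => (max (t - c) 0) ^ (m + 1)) =ᶠ[𝓝 t] fun _ => 0 := by
      filter_upwards [Iio_mem_nhds h] with u hu
      rw [max_eq_right (by linarith [mem_Iio.1 hu])]
      simp
    rw [max_eq_right (by linarith), zero_pow (by omega), mul_zero]
    exact (hasDerivAt_const t (0 : ℝ)).congr_of_eventuallyEq h1
  · subst h
    have h0 : (m + 1 : ℝ) * (max (t - t) 0) ^ m = 0 := by
      simp [show m ≠ 0 by omega]
    rw [h0, hasDerivAt_iff_isLittleO]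
    have h2 : (fun u : ℝ => (u - t) ^ (m + 1)) =o[𝓝 t] fun u => u - t := by
      have h3 : Tendsto (fun u : ℝ => u - t) (𝓝 t) (𝓝 0) := by
        have h4 : Continuous fun u : ℝ => u - t := by fun_prop
        simpa using h4.tendsto t
      have := (Asymptotics.isLittleO_pow_id (𝕜 := ℝ) (n := m + 1) (by omega)).comp_tendsto h3
      simpa [Function.comp_def] using this
    refine Asymptotics.IsBigO.trans_isLittleO ?_ h2
    refine Asymptotics.IsBigO.of_bound 1 (Eventually.of_forall fun u => ?_)
    simp only [sub_self, max_self, smul_zero, sub_zero, one_mul, norm_pow, ne_eq,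
      Nat.add_eq_zero_iff, one_ne_zero, and_false, not_false_eq_true, zero_pow]
    gcongr
    rw [Real.norm_eq_abs, Real.norm_eq_abs, abs_of_nonneg (le_max_right _ _)]
    exact max_le (le_abs_self _) (abs_nonneg _)
  · have h1 : (fun t : ℝ => (max (t - c) 0) ^ (m + 1)) =ᶠ[𝓝 t] fun t => (t - c) ^ (m + 1) := by
      filter_upwards [Ioi_mem_nhds h] with u hu
      rw [max_eq_left (by linarith [mem_Ioi.1 hu])]
    rw [max_eq_left (by linarith)]
    have := ((hlin t).pow (m + 1)).congr_of_eventuallyEq h1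
    simpa using this

theorem summable_descent_bound (R : ℝ) (j : ℕ) :
    Summable fun k : ℕ => R ^ (2 * k + j) / ((2 * k + j)! : ℝ) :=
  (Real.summable_pow_div_factorial R).comp_injective
    (i := fun k : ℕ => 2 * k + j) (fun a b h => by simpa using h)

theorem descent_term_bound {Δ R t : ℝ} (hΔ : 0 ≤ Δ) (hR : 0 ≤ R) (ht : t ≤ R) (k i : ℕ) :
    ‖(-1 : ℝ) ^ (k + 1) / ((i)! : ℝ) * (max (t - k * Δ) 0) ^ i‖ ≤ R ^ i / (i ! : ℝ) := by
  rw [norm_mul, norm_div, norm_pow, norm_neg, norm_one, one_pow, norm_pow, Real.norm_eq_abs,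
    Real.norm_eq_abs, abs_of_nonneg (le_max_right (t - k * Δ) 0), Nat.abs_cast, one_div,
    inv_mul_eq_div]
  have : max (t - k * Δ) 0 ≤ R := max_le (by nlinarith [mul_nonneg (Nat.cast_nonneg (α := ℝ) k) hΔ]) hR
  have h0 := le_max_right (t - k * Δ) 0
  gcongr

theorem summable_descent {Δ : ℝ} (hΔ : 0 ≤ Δ) (t : ℝ) (j : ℕ) :
    Summable fun k : ℕ =>
      (-1 : ℝ) ^ (k + 1) / ((2 * k + j)! : ℝ) * (max (t - k * Δ) 0) ^ (2 * k + j) :=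
  Summable.of_norm_bounded (summable_descent_bound |t| j) fun k =>
    descent_term_bound hΔ (abs_nonneg t) (le_abs_self t) k (2 * k + j)

theorem factorial_cast_succ (n : ℕ) : ((n + 1)! : ℝ) = ((n : ℝ) + 1) * (n ! : ℝ) := by
  rw [Nat.factorial_succ]
  push_cast
  ring

theorem hasDerivAt_descent {Δ : ℝ} (hΔ : 0 ≤ Δ) (t : ℝ) :
    HasDerivAt (descent Δ)
      (∑' k : ℕ, (-1 : ℝ) ^ (k + 1) / ((2 * k + 1)! : ℝ) * (max (t - k * Δ) 0) ^ (2 * k + 1)) t := by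
  have htR : t ∈ Iio (|t| + 1) := by
    have := le_abs_self t
    exact mem_Iio.2 (by linarith)
  refine (hasDerivAt_tsum_of_isPreconnected
    (g := fun (k : ℕ) (y : ℝ) =>
      (-1 : ℝ) ^ (k + 1) / ((2 * k + 2)! : ℝ) * (max (y - k * Δ) 0) ^ (2 * k + 2))
    (g' := fun (k : ℕ) (y : ℝ) =>
      (-1 : ℝ) ^ (k + 1) / ((2 * k + 1)! : ℝ) * (max (y - k * Δ) 0) ^ (2 * k + 1))
    (summable_descent_bound (|t| + 1) 1) isOpen_Iio isPreconnected_Iio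
    (fun k y _ => ?_) (fun k y hy => ?_) htR (summable_descent hΔ t 2) htR).const_add 1
  · have h := (hasDerivAt_max_pow (k * Δ) (2 * k + 1) (by omega) y).const_mul
      ((-1 : ℝ) ^ (k + 1) / ((2 * k + 2)! : ℝ))
    have e := factorial_cast_succ (2 * k + 1)
    refine h.congr_deriv ?_
    rw [← mul_assoc, e]
    congr 1
    have h1 : ((2 * k + 1)! : ℝ) ≠ 0 := Nat.cast_ne_zero.2 (Nat.factorial_ne_zero _)
    have h2 : ((2 * k + 1 : ℕ) : ℝ) + 1 ≠ 0 := Nat.cast_add_one_ne_zero _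
    generalize ((2 * k + 1)! : ℝ) = a at h1 ⊢
    field_simp
  · exact descent_term_bound hΔ (by positivity) (le_of_lt hy) k (2 * k + 1)

theorem hasDerivAt_deriv_descent {Δ : ℝ} (hΔ : 0 ≤ Δ) {t : ℝ} (ht : 0 < t) :
    HasDerivAt (deriv (descent Δ)) (-descent Δ (t - Δ)) t := by
  have e1 : deriv (descent Δ) = fun t => ∑' k : ℕ,
      (-1 : ℝ) ^ (k + 1) / ((2 * k + 1)! : ℝ) * (max (t - k * Δ) 0) ^ (2 * k + 1) :=
    funext fun t => (hasDerivAt_descent hΔ t).deriv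
  have e2 : -descent Δ (t - Δ) = ∑' k : ℕ,
      (-1 : ℝ) ^ (k + 1) / ((2 * k + 0)! : ℝ) * (max (t - k * Δ) 0) ^ (2 * k + 0) := by
    rw [(summable_descent hΔ t 0).tsum_eq_zero_add, descent, neg_add, ← tsum_neg]
    congr 1
    · simp
    · refine tsum_congr fun k => ?_
      have a1 : t - Δ - k * Δ = t - ((k + 1 : ℕ) : ℝ) * Δ := by push_cast; ring
      have a2 : 2 * (k + 1) + 0 = 2 * k + 2 := by ring
      rw [a1, a2, pow_succ (-1 : ℝ) (k + 1)]
      ring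
  rw [e1, e2]
  have htR : t ∈ Ioo 0 (t + 1) := ⟨ht, by linarith⟩
  refine hasDerivAt_tsum_of_isPreconnected
    (g := fun (k : ℕ) (y : ℝ) =>
      (-1 : ℝ) ^ (k + 1) / ((2 * k + 1)! : ℝ) * (max (y - k * Δ) 0) ^ (2 * k + 1))
    (g' := fun (k : ℕ) (y : ℝ) =>
      (-1 : ℝ) ^ (k + 1) / ((2 * k + 0)! : ℝ) * (max (y - k * Δ) 0) ^ (2 * k + 0))
    (summable_descent_bound (t + 1) 0) isOpen_Ioo isPreconnected_Ioo
    (fun k y hy => ?_) (fun k y hy => ?_) htR (summable_descent hΔ t 1) htR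
  · rcases Nat.eq_zero_or_pos k with rfl | hk
    · have h1 : (fun u : ℝ => (-1 : ℝ) ^ (0 + 1) / ((2 * 0 + 1)! : ℝ) *
          (max (u - ((0 : ℕ) : ℝ) * Δ) 0) ^ (2 * 0 + 1)) =ᶠ[𝓝 y] fun u => -u := by
        filter_upwards [Ioi_mem_nhds hy.1] with u hu
        have : (0 : ℝ) < u := hu
        simp [max_eq_left this.le]
      have h2 := (hasDerivAt_neg y).congr_of_eventuallyEq h1
      simpa using h2
    · have h := (hasDerivAt_max_pow (k * Δ) (2 * k) (by omega) y).const_mul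
        ((-1 : ℝ) ^ (k + 1) / ((2 * k + 1)! : ℝ))
      have e := factorial_cast_succ (2 * k)
      refine h.congr_deriv ?_
      rw [← mul_assoc, e]
      simp only [add_zero]
      congr 1
      have h1 : ((2 * k)! : ℝ) ≠ 0 := Nat.cast_ne_zero.2 (Nat.factorial_ne_zero _)
      have h2 : ((2 * k : ℕ) : ℝ) + 1 ≠ 0 := Nat.cast_add_one_ne_zero _
      generalize ((2 * k)! : ℝ) = a at h1 ⊢
      field_simp
  · exact descent_term_bound hΔ (by linarith) (le_of_lt hy.2) k (2 * k + 0)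

/-- `descent Δ` is indeed the solution `r_Δ` of the autonomous delay equation. -/
theorem descent_isSolution {Δ : ℝ} (hΔ : 0 ≤ Δ) :
    (∀ t ≤ 0, descent Δ t = 1) ∧ Differentiable ℝ (descent Δ) ∧ deriv (descent Δ) 0 = 0 ∧
      ∀ t, 0 < t → HasDerivAt (deriv (descent Δ)) (-descent Δ (t - Δ)) t := by
  have key : ∀ t ≤ 0, ∀ k : ℕ, max (t - k * Δ) 0 = 0 := fun t ht k =>
    max_eq_right (by nlinarith [mul_nonneg (Nat.cast_nonneg (α := ℝ) k) hΔ])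
  refine ⟨fun t ht => ?_, fun t => (hasDerivAt_descent hΔ t).differentiableAt, ?_,
    fun t ht => hasDerivAt_deriv_descent hΔ ht⟩
  · simp [descent, key t ht]
  · rw [(hasDerivAt_descent hΔ 0).deriv]
    refine (tsum_congr fun k => ?_).trans tsum_zero
    rw [key 0 le_rfl k, zero_pow (by omega), mul_zero]

/-- The first zero `ϑ_Δ` of `r_Δ`. -/
def descentZero (Δ : ℝ) : ℝ :=
  sInf {t : ℝ | 0 < t ∧ descent Δ t = 0}

/-! ### The ascent time `Ψ(ρ, Δ)` -/

/-- The forcing term `max {β(v), ρ r_Δ(ϑ_Δ - v - Δ) χ_{[-Δ,0]}(v)}`. -/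
def ascentForcing (ρ Δ : ℝ) (β : ℝ → ℝ) (v : ℝ) : ℝ :=
  max (β v) ((Icc (-Δ) 0).indicator (fun v => ρ * descent Δ (descentZero Δ - v - Δ)) v)

/-- The (unique) `ϖ > 0` with `∫_{-ϖ}^0 ∫_{-ϖ}^s max {…} dw ds = 1`. -/
def ascentLength (ρ Δ : ℝ) (β : ℝ → ℝ) : ℝ :=
  sInf {ω : ℝ | 0 < ω ∧ (∫ s in (-ω)..0, ∫ w in (-ω)..s, ascentForcing ρ Δ β w) = 1}

/-- The functions `β_n` on `(-∞, 0]` (their values on `(0, ∞)` are irrelevant): `β_0 = 1`, and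
`β_{n+1} = 1` on `(-∞, -ϖ_n]`,
`β_{n+1}(t) = 1 - ∫_{-ϖ_n}^t ∫_{-ϖ_n}^s max {β_n(v), …} dv ds` on `[-ϖ_n, 0]`. -/
def ascentBound (ρ Δ : ℝ) : ℕ → ℝ → ℝ
  | 0 => fun _ => 1
  | n + 1 => fun t =>
      if t ≤ -ascentLength ρ Δ (ascentBound ρ Δ n) then 1
      else 1 - ∫ s in (-ascentLength ρ Δ (ascentBound ρ Δ n))..t,
        ∫ v in (-ascentLength ρ Δ (ascentBound ρ Δ n))..s,
          ascentForcing ρ Δ (ascentBound ρ Δ n) v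

/-- `Ψ(ρ, Δ) = lim_n ϖ_n`, where `ϖ_n` is the length belonging to `β_n`. -/
def ascentTime (ρ Δ : ℝ) : ℝ :=
  limUnder atTop fun n : ℕ => ascentLength ρ Δ (ascentBound ρ Δ n)

end

/-!
The statement consists of three parts.

*The critical delay.* In the reflected time `u = -v`, one step of the iteration for `Ψ(1, Δ)` solves
`b'' = -F` with `b(0) = 0`, `b'(ω) = 0`, the length `ω` being determined by `b(ω) = 1`; equivalently
`∫₀^ω r F(r) dr = 1` and `b(u) = ∫₀^ω min(r, u) F(r) dr`. For `Δ ≥ √2` the comparison function is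
explicit: `r_Δ(t) = 1 - t² / 2` on `[0, √2]` and `ϑ_Δ = √2`. The comparison principle
`greenIntegral_comparison` (larger `F`, shorter interval, larger `b`) shows that the lengths `ϖ_n`
increase, that they stay in `[√2, π / 2]`, and that `Ψ(1, Δ)` is antitone in `Δ`
(`ascentTime_antitone`), so that there is at most one fixed point `γ`. If `Δ = ω = γ`, then in the
time `t = γ - u` the limiting problem does not involve `γ`, and its right-hand side is the maximum of
`cos t` and `r_Δ(√2 - t)`; this defines `γ`. That the iteration for `Δ = γ` converges to this
solution follows from the monotonicity of a Wronskian (`length_eq_of_le`).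

*The four behaviours.* With `q = -p ≥ 0` a nonoscillatory solution is eventually convex or concave,
and since `q` is not integrable it tends to `0` or to `±∞` together with its derivative
(`PositiveFeedback.of_eventually_pos`). Let `x` oscillate, let `x(a) = 0`, and let `|x| ≤ M` up to
time `a`. Comparison with a parabola shows `|x(a - u)| ≤ √(2 P) M u`, where `q ≤ P`. On the semicycle
after `a`, only these values of `x` can bend the graph towards zero, and this bounds the height of
the semicycle by `(√2 / 6) (τ_m √P)³ M` (`PositiveFeedback.le_on_semicycle`). The factor is less than
one if `τ_m √P ≤ π / 2`, in particular if `τ_m √P < γ`, so that `x` tends to zero geometrically.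

*A decaying solution.* If `τ_m √P ≤ 2 / e`, there is `ν > 0` with `P exp (ν τ_m) ≤ ν²`. For
`X(t) = exp (ν t) x(t)` the equation is a linear fixed point problem whose operator is positive with
respect to the cone of nonnegative nondecreasing functions, and for which `exp (ν t)` is an upper
solution. Monotone iteration (`DecayData.exists_fixedPoint`) gives a solution with `0 < x ≤ 1`, which
can only have the second behaviour.
-/

/-! ### Monotonicity from a bound on the almost everywhere derivative -/

theorem AbsolutelyContinuousOnInterval.monotoneOn_of_ae_deriv_nonneg {f f' : ℝ → ℝ} {a b : ℝ}
    (hf : AbsolutelyContinuousOnInterval f a b)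
    (hd : ∀ᵐ t, t ∈ Icc a b → HasDerivAt f (f' t) t ∧ 0 ≤ f' t) : MonotoneOn f (Icc a b) := by
  intro u hu v hv huv
  have hac : AbsolutelyContinuousOnInterval f u v := by
    refine hf.mono ?_
    rw [uIcc_of_le huv, uIcc_of_le (hu.1.trans hu.2)]
    exact Icc_subset_Icc hu.1 hv.2
  have h1 := hac.integral_deriv_eq_sub
  have h2 : 0 ≤ ∫ t in u..v, deriv f t := by
    refine intervalIntegral.integral_nonneg_of_ae_restrict huv ?_
    rw [EventuallyLE, ae_restrict_iff' measurableSet_Icc]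
    filter_upwards [hd] with t ht htm
    have h := ht ⟨hu.1.trans htm.1, htm.2.trans hv.2⟩
    rw [h.1.deriv]
    exact h.2
  linarith

/-! ### Equations with positive feedback -/

/-- On `(s, ∞)` the function `x` has a locally absolutely continuous derivative and satisfies
`x''(t) = q(t) x(t - τ(t))` almost everywhere, with a feedback coefficient `0 ≤ q ≤ P` and a delay
`0 ≤ τ ≤ Δ`. -/
structure PositiveFeedback (q τ : ℝ → ℝ) (s Δ P : ℝ) (x : ℝ → ℝ) : Prop where
  hasDerivAt : ∀ t, s < t → HasDerivAt x (deriv x t) t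
  absCont : ∀ a b, s < a → a ≤ b → AbsolutelyContinuousOnInterval (deriv x) a b
  equation : ∀ᵐ t, s < t → HasDerivAt (deriv x) (q t * x (t - τ t)) t
  coeff_nonneg : ∀ t, 0 ≤ q t
  coeff_le : ∀ᵐ t, q t ≤ P
  delay_nonneg : ∀ t, 0 ≤ τ t
  delay_le : ∀ᵐ t, s < t → τ t ≤ Δ

namespace PositiveFeedback

variable {q τ x : ℝ → ℝ} {s Δ P : ℝ}

theorem neg (h : PositiveFeedback q τ s Δ P x) : PositiveFeedback q τ s Δ P (fun t => -x t) := by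
  have e : deriv (fun t => -x t) = fun t => -deriv x t := by
    funext t
    exact deriv.fun_neg
  refine ⟨fun t ht => ?_, fun a b ha hab => ?_, ?_, h.coeff_nonneg, h.coeff_le, h.delay_nonneg,
    h.delay_le⟩
  · rw [e]
    exact (h.hasDerivAt t ht).neg
  · rw [e]
    exact (h.absCont a b ha hab).fun_neg
  · rw [e]
    filter_upwards [h.equation] with t ht hs
    refine (ht hs).fun_neg.congr_deriv ?_
    ring

theorem continuousOn (h : PositiveFeedback q τ s Δ P x) : ContinuousOn x (Ioi s) :=
  fun t ht => (h.hasDerivAt t ht).continuousAt.continuousWithinAt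

/-- Adding a function of class `C²` to `x`: a lower bound on the sum of the second derivatives
makes the sum of the first derivatives monotone. -/
theorem monotoneOn_deriv_add (h : PositiveFeedback q τ s Δ P x) {a b : ℝ} (ha : s < a)
    (hab : a ≤ b) {g g' : ℝ → ℝ} (hg : ∀ t, HasDerivAt g (g' t) t) (hg' : Continuous g')
    (hpos : ∀ᵐ t, t ∈ Icc a b → 0 ≤ q t * x (t - τ t) + g' t) :
    MonotoneOn (fun t => deriv x t + g t) (Icc a b) := by
  have hgc : ContDiff ℝ 1 g := by
    rw [contDiff_one_iff_deriv]
    refine ⟨fun t => (hg t).differentiableAt, ?_⟩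
    rwa [show deriv g = g' from funext fun t => (hg t).deriv]
  refine ((h.absCont a b ha hab).fun_add
    (hgc.contDiffOn.absolutelyContinuousOnInterval)).monotoneOn_of_ae_deriv_nonneg
    (f' := fun t => q t * x (t - τ t) + g' t) ?_
  filter_upwards [h.equation, hpos] with t h1 h2 ht
  exact ⟨(h1 (ha.trans_le ht.1)).fun_add (hg t), h2 ht⟩

/-- Going back from a zero `a`, a solution bounded by `M` (so that `x'' ≤ P M`) cannot be below the
parabola of curvature `P M` that starts from the value `-M` with slope zero; here only the tangent
of that parabola at `a` is kept. The length `L` with `P L² = 2` is the time in which the parabola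
reaches zero. -/
theorem neg_le_of_zero (h : PositiveFeedback q τ s Δ P x) {T a M L : ℝ} (hT : s < T) (hL : 0 < L)
    (hPL : P * L ^ 2 = 2) (hM : 0 ≤ M) (ha : x a = 0) (hTa : T + Δ + L ≤ a) (hΔ : 0 ≤ Δ)
    (hbd : ∀ t ∈ Icc T a, |x t| ≤ M) {t : ℝ} (ht : t ∈ Icc T a) :
    -x t ≤ M * P * L * (a - t) := by
  have hP : 0 < P := by
    by_contra hP
    nlinarith [sq_nonneg L]
  by_cases htL : t ≤ a - L
  · have h1 := (abs_le.1 (hbd t ht)).1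
    have h2 : M * P * L * L ≤ M * P * L * (a - t) :=
      mul_le_mul_of_nonneg_left (by linarith) (by positivity)
    nlinarith
  push Not at htL
  have hmono := h.neg.monotoneOn_deriv_add (a := a - L) (b := a) (by linarith) (by linarith)
    (g := fun t => M * P * L - M * P * (a - t)) (g' := fun _ => M * P) (fun t => by
      have := ((hasDerivAt_id t).const_sub a).const_mul (M * P) |>.const_sub (M * P * L)
      simpa using this) continuous_const (by
      filter_upwards [h.coeff_le, h.delay_le] with r h1 h2 hr
      have h3 := h2 (by linarith [hr.1])
      have h4 := h.delay_nonneg r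
      have h5 := h.coeff_nonneg r
      have h6 := (abs_le.1 (hbd (r - τ r) ⟨by linarith [hr.1], by linarith [hr.2]⟩)).2
      have h7 : q r * x (r - τ r) ≤ q r * M := mul_le_mul_of_nonneg_left h6 h5
      have h8 : q r * M ≤ P * M := mul_le_mul_of_nonneg_right h1 hM
      nlinarith)
  have hder : ∀ r ∈ Icc (a - L) a,
      HasDerivAt (fun r => -x r - (M * P * L * (a - r) - M * P * (a - r) ^ 2 / 2))
        (deriv (fun t => -x t) r + (M * P * L - M * P * (a - r))) r := by
    intro r hr
    have h1 := h.neg.hasDerivAt r (by linarith [hr.1])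
    have h2 : HasDerivAt (fun r => a - r) (-1) r := by
      simpa using (hasDerivAt_id r).const_sub a
    have h3 := (h2.const_mul (M * P * L)).sub (((h2.pow 2).const_mul (M * P)).div_const 2)
    refine (h1.sub h3).congr_deriv ?_
    simp
    ring
  have hconv : ConvexOn ℝ (Icc (a - L) a)
      (fun r => -x r - (M * P * L * (a - r) - M * P * (a - r) ^ 2 / 2)) := by
    refine MonotoneOn.convexOn_of_deriv (convex_Icc _ _)
      (fun r hr => (hder r hr).continuousAt.continuousWithinAt)
      (fun r hr => (hder r (interior_subset hr)).differentiableAt.differentiableWithinAt) ?_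
    intro u hu v hv huv
    rw [(hder u (interior_subset hu)).deriv, (hder v (interior_subset hv)).deriv]
    exact hmono (interior_subset hu) (interior_subset hv) huv
  have hmax := hconv.le_max_of_mem_Icc (left_mem_Icc.2 (by linarith))
    (right_mem_Icc.2 (by linarith)) (z := t) ⟨htL.le, ht.2⟩
  have hend : -x (a - L) ≤ M := by
    have := (abs_le.1 (hbd (a - L) ⟨by linarith, by linarith⟩)).1
    linarith
  have hle : max (-x (a - L) - (M * P * L * (a - (a - L)) - M * P * (a - (a - L)) ^ 2 / 2))
      (-x a - (M * P * L * (a - a) - M * P * (a - a) ^ 2 / 2)) ≤ 0 := by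
    refine max_le ?_ ?_
    · have : M * P * L * (a - (a - L)) - M * P * (a - (a - L)) ^ 2 / 2 = M := by
        linear_combination (M / 2) * hPL
      rw [this]
      linarith
    · simp [ha]
  have hsq : 0 ≤ M * P * (a - t) ^ 2 / 2 := by positivity
  have h9 := hmax.trans hle
  beta_reduce at h9
  linarith

/-- The height of a semicycle `[a, b]`: by `neg_le_of_zero` the values of `x` shortly before `a` are
small, which limits how long and how strongly `x'` can be brought down from a positive value to the
zero it has at the maximum. -/
theorem le_on_semicycle (h : PositiveFeedback q τ s Δ P x) {T a b M L : ℝ} (hT : s < T)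
    (hL : 0 < L) (hPL : P * L ^ 2 = 2) (hM : 0 ≤ M) (ha : x a = 0) (hb : x b = 0)
    (hTa : T + Δ + L ≤ a) (hΔ : 0 ≤ Δ) (hbd : ∀ t ∈ Icc T a, |x t| ≤ M)
    (hpos : ∀ t ∈ Icc a b, 0 ≤ x t) {t : ℝ} (ht : t ∈ Icc a b) :
    x t ≤ M * P ^ 2 * L * Δ ^ 3 / 6 := by
  have hP : 0 < P := by
    by_contra hP
    nlinarith [sq_nonneg L]
  have hTa' : T ≤ a := by linarith
  have hbound0 : 0 ≤ M * P ^ 2 * L * Δ ^ 3 / 6 := by positivity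
  obtain ⟨ξ, hξ, hξmax⟩ := isCompact_Icc.exists_isMaxOn ⟨t, ht⟩
    (h.continuousOn.mono (fun r (hr : r ∈ Icc a b) => mem_Ioi.2 (by linarith [hr.1])))
  refine (hξmax ht).trans ?_
  by_cases hx0 : x ξ = 0
  · rw [hx0]
    exact hbound0
  have hξa : a < ξ := lt_of_le_of_ne hξ.1 (fun e => hx0 (e ▸ ha))
  have hξb : ξ < b := lt_of_le_of_ne hξ.2 (fun e => hx0 (e ▸ hb))
  have hd0 : deriv x ξ = 0 := by
    have : IsLocalMax x ξ := hξmax.isLocalMax (Icc_mem_nhds hξa hξb)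
    exact this.deriv_eq_zero
  have hlin : ∀ r, HasDerivAt (fun r => (max (a + Δ - r) 0) ^ 2) (-(2 * max (a + Δ - r) 0)) r := by
    intro r
    have h1 := (hasDerivAt_max_pow (-(a + Δ)) 1 le_rfl (-r)).comp r (hasDerivAt_neg r)
    refine (h1.congr_deriv (by
      rw [show -r - -(a + Δ) = a + Δ - r by ring]
      norm_num)).congr_of_eventuallyEq (Eventually.of_forall fun u => ?_)
    simp only [Function.comp]
    rw [show -u - -(a + Δ) = a + Δ - u by ring]
  have hcub : ∀ r, HasDerivAt (fun r => (max (a + Δ - r) 0) ^ 3)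
      (-(3 * max (a + Δ - r) 0 ^ 2)) r := by
    intro r
    have h1 := (hasDerivAt_max_pow (-(a + Δ)) 2 (by norm_num) (-r)).comp r (hasDerivAt_neg r)
    refine (h1.congr_deriv (by
      rw [show -r - -(a + Δ) = a + Δ - r by ring]
      norm_num)).congr_of_eventuallyEq (Eventually.of_forall fun u => ?_)
    simp only [Function.comp]
    rw [show -u - -(a + Δ) = a + Δ - u by ring]
  set C := M * P ^ 2 * L with hC
  have hC0 : 0 ≤ C := by positivity
  have hmono := h.monotoneOn_deriv_add (a := a) (b := ξ) (by linarith) hξa.le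
    (g := fun r => -(C / 2) * (max (a + Δ - r) 0) ^ 2)
    (g' := fun r => -(C / 2) * (-(2 * max (a + Δ - r) 0)))
    (fun r => (hlin r).const_mul _) (by fun_prop) (by
      filter_upwards [h.coeff_le, h.delay_le] with r h1 h2 hr
      have h3 := h2 (by linarith [hr.1])
      have h4 := h.delay_nonneg r
      have h5 := h.coeff_nonneg r
      have h6 : 0 ≤ max (a + Δ - r) 0 := le_max_right _ _
      have h7 : a + Δ - r ≤ max (a + Δ - r) 0 := le_max_left _ _
      have h8 : -(M * P * L * max (a + Δ - r) 0) ≤ x (r - τ r) := by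
        rcases le_total a (r - τ r) with h9 | h9
        · have := hpos (r - τ r) ⟨h9, by linarith [hr.2]⟩
          have : 0 ≤ M * P * L * max (a + Δ - r) 0 := by positivity
          linarith
        · have h10 := h.neg_le_of_zero hT hL hPL hM ha hTa hΔ hbd (t := r - τ r)
            ⟨by linarith [hr.1], h9⟩
          have h11 : M * P * L * (a - (r - τ r)) ≤ M * P * L * max (a + Δ - r) 0 :=
            mul_le_mul_of_nonneg_left (by linarith) (by positivity)
          linarith
      have h12 : 0 ≤ M * P * L * max (a + Δ - r) 0 := by positivity
      have h13 := mul_le_mul_of_nonneg_left h8 h5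
      have h14 := mul_le_mul_of_nonneg_right h1 h12
      have h15 : C * max (a + Δ - r) 0 = P * (M * P * L * max (a + Δ - r) 0) := by
        rw [hC]; ring
      linarith)
  have hder : ∀ r ∈ Icc a ξ, HasDerivAt (fun r => x r + C / 6 * (max (a + Δ - r) 0) ^ 3)
      (deriv x r + C / 6 * -(3 * max (a + Δ - r) 0 ^ 2)) r := fun r hr =>
    (h.hasDerivAt r (by linarith [hr.1])).fun_add ((hcub r).const_mul _)
  have hanti : AntitoneOn (fun r => x r + C / 6 * (max (a + Δ - r) 0) ^ 3) (Icc a ξ) := by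
    refine antitoneOn_of_deriv_nonpos (convex_Icc _ _)
      (fun r hr => (hder r hr).continuousAt.continuousWithinAt)
      (fun r hr => (hder r (interior_subset hr)).differentiableAt.differentiableWithinAt) ?_
    intro r hr
    have hr' := interior_subset hr
    rw [(hder r hr').deriv]
    have h1 := hmono hr' (right_mem_Icc.2 hξa.le) hr'.2
    simp only [hd0] at h1
    have h2 : 0 ≤ C / 2 * max (a + Δ - ξ) 0 ^ 2 := by positivity
    linarith
  have h1 := hanti (left_mem_Icc.2 hξa.le) (right_mem_Icc.2 hξa.le) hξa.le
  have h2 : 0 ≤ C / 6 * max (a + Δ - ξ) 0 ^ 3 := by positivity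
  simp only [ha, show a + Δ - a = Δ by ring, max_eq_left hΔ] at h1
  linarith

end PositiveFeedback

namespace PositiveFeedback

variable {q τ x : ℝ → ℝ} {s Δ P : ℝ}

/-- A point where an oscillatory function does not vanish lies between two consecutive zeros. -/
theorem exists_semicycle (h : PositiveFeedback q τ s Δ P x) (hosc : Oscillatory x) {z t : ℝ}
    (hz : s < z) (hxz : x z = 0) (hzt : z ≤ t) :
    ∃ a b, z ≤ a ∧ a ≤ t ∧ t ≤ b ∧ x a = 0 ∧ x b = 0 ∧
      (0 ≤ x t → ∀ r ∈ Icc a b, 0 ≤ x r) ∧ (x t ≤ 0 → ∀ r ∈ Icc a b, x r ≤ 0) := by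
  rcases eq_or_ne (x t) 0 with h0 | h0
  · refine ⟨t, t, hzt, le_rfl, le_rfl, h0, h0, fun _ r hr => ?_, fun _ r hr => ?_⟩ <;>
      rw [show r = t from le_antisymm hr.2 hr.1, h0]
  have hcont : ∀ u v, z ≤ u → ContinuousOn x (Icc u v) := fun u v hu =>
    h.continuousOn.mono fun r hr => hz.trans_le (hu.trans hr.1)
  obtain ⟨e, hte, hxe⟩ := hosc t
  have key : ∀ u v, z ≤ u → IsCompact (Icc u v ∩ x ⁻¹' {0}) := fun u v hu =>
    isCompact_Icc.of_isClosed_subset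
      ((hcont u v hu).preimage_isClosed_of_isClosed isClosed_Icc isClosed_singleton)
      inter_subset_left
  obtain ⟨a, ⟨haI, hxa⟩, hamax⟩ := (key z t le_rfl).exists_isGreatest ⟨z, ⟨le_rfl, hzt⟩, hxz⟩
  obtain ⟨b, ⟨hbI, hxb⟩, hbmin⟩ := (key t e hzt).exists_isLeast ⟨e, ⟨hte, le_rfl⟩, hxe⟩
  have hxa : x a = 0 := hxa
  have hxb : x b = 0 := hxb
  have hne : ∀ r ∈ Ioo a b, x r ≠ 0 := by
    intro r hr h1
    rcases le_total r t with h2 | h2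
    · exact absurd (hamax ⟨⟨haI.1.trans hr.1.le, h2⟩, h1⟩) (not_le.2 hr.1)
    · exact absurd (hbmin ⟨⟨h2, hr.2.le.trans hbI.2⟩, h1⟩) (not_le.2 hr.2)
  have htab : t ∈ Ioo a b :=
    ⟨lt_of_le_of_ne haI.2 fun e => h0 (e ▸ hxa), lt_of_le_of_ne hbI.1 fun e => h0 (e ▸ hxb)⟩
  have hcont' : ContinuousOn x (Ioo a b) := (hcont a b haI.1).mono Ioo_subset_Icc_self
  have hiv : ∀ r ∈ Ioo a b, 0 < x r * x t := by
    intro r hr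
    by_contra hneg
    push Not at hneg
    obtain ⟨c, hc, hc0⟩ : (0 : ℝ) ∈ x '' Ioo a b := by
      rcases lt_or_gt_of_ne h0 with h1 | h1
      · exact isPreconnected_Ioo.intermediate_value htab hr hcont' ⟨h1.le, by nlinarith⟩
      · exact isPreconnected_Ioo.intermediate_value hr htab hcont' ⟨by nlinarith, h1.le⟩
    exact hne c hc hc0
  refine ⟨a, b, haI.1, haI.2, hbI.1, hxa, hxb, fun h1 r hr => ?_, fun h1 r hr => ?_⟩
  all_goals
    rcases eq_or_lt_of_le hr.1 with h2 | h2
    · rw [← h2, hxa]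
    rcases eq_or_lt_of_le hr.2 with h3 | h3
    · rw [h3, hxb]
    have := hiv r ⟨h2, h3⟩
  · nlinarith [lt_of_le_of_ne h1 h0.symm]
  · nlinarith [lt_of_le_of_ne h1 h0]

/-- A bound for `|x|` on a long enough interval that ends at a zero improves, from that zero on, by
the factor `κ`. -/
theorem abs_le_after_zero (h : PositiveFeedback q τ s Δ P x) (hosc : Oscillatory x)
    {T z M L κ : ℝ} (hT : s < T) (hL : 0 < L) (hPL : P * L ^ 2 = 2) (hM : 0 < M) (hz : x z = 0)
    (hTz : T + Δ + L ≤ z) (hΔ : 0 ≤ Δ) (hκ : P ^ 2 * L * Δ ^ 3 / 6 ≤ κ) (hκ1 : κ < 1)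
    (hbd : ∀ t ∈ Icc T z, |x t| ≤ M) {t : ℝ} (ht : z ≤ t) : |x t| ≤ κ * M := by
  have hsemi : ∀ r, z ≤ r → (∀ u ∈ Icc T r, |x u| ≤ M) → |x r| ≤ κ * M := by
    intro r hr hb
    obtain ⟨a, b, hza, har, hrb, hxa, hxb, hp, hn⟩ :=
      h.exists_semicycle hosc (by linarith) hz hr
    have hb' : ∀ u ∈ Icc T a, |x u| ≤ M := fun u hu => hb u ⟨hu.1, hu.2.trans har⟩
    have hκM := mul_le_mul_of_nonneg_right hκ hM.le
    rcases le_total 0 (x r) with h1 | h1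
    · rw [abs_of_nonneg h1]
      have := h.le_on_semicycle hT hL hPL hM.le hxa hxb (by linarith) hΔ hb' (hp h1) ⟨har, hrb⟩
      linarith
    · rw [abs_of_nonpos h1]
      have := h.neg.le_on_semicycle hT hL hPL hM.le (by simp [hxa]) (by simp [hxb])
        (by linarith) hΔ (by simpa using hb') (fun u hu => neg_nonneg.2 (hn h1 u hu)) ⟨har, hrb⟩
      linarith
  have hcont : ContinuousOn (fun r => |x r|) (Icc z t) :=
    (h.continuousOn.mono fun r hr => mem_Ioi.2 (by linarith [hr.1])).abs
  -- the bound `M` cannot be attained for the first time, as it would be undercut there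
  have hall : ∀ r ∈ Icc z t, |x r| < M := by
    intro r hr
    by_contra hcon
    push Not at hcon
    have hcomp : IsCompact (Icc z t ∩ (fun r => |x r|) ⁻¹' Ici M) :=
      isCompact_Icc.of_isClosed_subset
        (hcont.preimage_isClosed_of_isClosed isClosed_Icc isClosed_Ici) inter_subset_left
    obtain ⟨c, ⟨hcI, hcM⟩, hcmin⟩ := hcomp.exists_isLeast ⟨r, hr, hcon⟩
    have hcM : M ≤ |x c| := hcM
    have hlt : ∀ u ∈ Ico z c, |x u| < M := by
      intro u hu
      by_contra h1
      push Not at h1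
      exact absurd (hcmin ⟨⟨hu.1, hu.2.le.trans hcI.2⟩, h1⟩) (not_le.2 hu.2)
    have hzc : z < c := by
      refine lt_of_le_of_ne hcI.1 fun e => ?_
      rw [← e, hz, abs_zero] at hcM
      linarith
    have hle : |x c| ≤ M := by
      have hcl : c ∈ closure (Ico z c) := by
        rw [closure_Ico hzc.ne]
        exact right_mem_Icc.2 hzc.le
      have hcw : ContinuousWithinAt (fun r => |x r|) (Ico z c) c :=
        (hcont c hcI).mono fun u hu => ⟨hu.1, hu.2.le.trans hcI.2⟩
      exact hcw.closure_le hcl continuousWithinAt_const fun u hu => (hlt u hu).le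
    have := hsemi c hcI.1 fun u hu => by
      rcases le_total u z with h1 | h1
      · exact hbd u ⟨hu.1, h1⟩
      · rcases eq_or_lt_of_le hu.2 with h2 | h2
        · rw [h2]; exact hle
        · exact (hlt u ⟨h1, h2⟩).le
    nlinarith
  refine hsemi t ht fun u hu => ?_
  rcases le_total u z with h1 | h1
  · exact hbd u ⟨hu.1, h1⟩
  · exact (hall u ⟨h1, hu.2⟩).le

/-- Zeros far out give a sequence of times after which `|x|` is bounded by `κ ^ n M`. -/
theorem tendsto_zero_of_oscillatory (h : PositiveFeedback q τ s Δ P x) (hosc : Oscillatory x)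
    (hP : 0 < P) (hΔ : 0 ≤ Δ) (hPΔ : Δ * √P ≤ Real.pi / 2) : Tendsto x atTop (𝓝 0) := by
  set L := √(2 / P) with hLdef
  have hL : 0 < L := Real.sqrt_pos.2 (by positivity)
  have hPL : P * L ^ 2 = 2 := by
    rw [hLdef, Real.sq_sqrt (by positivity)]
    field_simp
  -- with `y = Δ √P` the contraction factor is `√2 y ^ 3 / 6`, and `y ≤ π / 2 < 1.6`
  have hκ : P ^ 2 * L * Δ ^ 3 / 6 ≤ 97 / 100 := by
    have hy : (Δ * √P) ^ 2 ≤ (8 / 5) ^ 2 := by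
      have := Real.pi_lt_d2
      gcongr
      linarith
    rw [mul_pow, Real.sq_sqrt hP.le] at hy
    have h3 : (Δ ^ 2 * P) ^ 3 ≤ ((8 / 5) ^ 2) ^ 3 := by gcongr
    have h4 : (P ^ 2 * L * Δ ^ 3) ^ 2 = 2 * (Δ ^ 2 * P) ^ 3 := by
      linear_combination (P ^ 3 * Δ ^ 6) * hPL
    have h5 : (P ^ 2 * L * Δ ^ 3) ^ 2 ≤ (5.81 : ℝ) ^ 2 := by
      rw [h4]
      norm_num at h3 ⊢
      linarith
    have := abs_le_of_sq_le_sq h5 (by norm_num)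
    linarith [le_abs_self (P ^ 2 * L * Δ ^ 3)]
  set κ : ℝ := 97 / 100 with hκdef
  have hdecay : ∃ M : ℝ, 0 < M ∧ ∀ n : ℕ, ∃ T, s < T ∧ ∀ t, T ≤ t → |x t| ≤ κ ^ n * M := by
    obtain ⟨z, hz, hxz⟩ := hosc (s + 1 + Δ + L)
    obtain ⟨M, hM⟩ := (isCompact_Icc (a := s + 1) (b := z)).exists_bound_of_continuousOn
      (h.continuousOn.mono fun r hr => mem_Ioi.2 (by linarith [hr.1]))
    have hM' : ∀ t ∈ Icc (s + 1) z, |x t| ≤ max M 1 := fun t ht =>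
      (hM t ht).trans (le_max_left _ _)
    refine ⟨max M 1, by positivity, fun n => ?_⟩
    induction n with
    | zero =>
      refine ⟨z, by linarith, fun t ht => ?_⟩
      have := h.abs_le_after_zero hosc (by linarith) hL hPL (by positivity) hxz hz hΔ hκ
        (by norm_num [hκdef]) hM' ht
      refine this.trans ?_
      rw [pow_zero]
      exact mul_le_mul_of_nonneg_right (by norm_num [hκdef]) (by positivity)
    | succ n ih =>
      obtain ⟨T, hT, hTb⟩ := ih
      obtain ⟨w, hw, hxw⟩ := hosc (T + Δ + L)
      refine ⟨w, by linarith, fun t ht => ?_⟩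
      rw [pow_succ', mul_assoc]
      exact h.abs_le_after_zero hosc hT hL hPL (by positivity) hxw hw hΔ hκ
        (by norm_num [hκdef]) (fun u hu => hTb u hu.1) ht
  obtain ⟨M, hM0, hM⟩ := hdecay
  rw [Metric.tendsto_atTop]
  intro ε hε
  obtain ⟨n, hn⟩ := exists_pow_lt_of_lt_one (div_pos hε hM0) (show κ < 1 by norm_num [hκdef])
  obtain ⟨T, -, hT⟩ := hM n
  refine ⟨T, fun t ht => ?_⟩
  rw [Real.dist_eq, sub_zero]
  exact (hT t ht).trans_lt ((lt_div_iff₀ hM0).1 hn)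

end PositiveFeedback

namespace PositiveFeedback

variable {q τ x : ℝ → ℝ} {s Δ P : ℝ}

theorem monotoneOn_deriv (h : PositiveFeedback q τ s Δ P x) {T : ℝ} (hT : s < T) (hΔ : 0 ≤ Δ)
    (hpos : ∀ t, T ≤ t → 0 ≤ x t) : MonotoneOn (deriv x) (Ici (T + Δ)) := by
  intro u hu v hv huv
  have hu : T + Δ ≤ u := hu
  have := h.monotoneOn_deriv_add (a := u) (b := v) (by linarith) huv (g := fun _ => 0)
    (g' := fun _ => 0) (fun t => hasDerivAt_const t 0) continuous_const (by
      filter_upwards [h.delay_le] with r h1 hr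
      have := mul_nonneg (h.coeff_nonneg r) (hpos (r - τ r) (by
        linarith [hr.1, h1 (by linarith [hr.1])]))
      linarith) (left_mem_Icc.2 huv) (right_mem_Icc.2 huv) huv
  simpa using this

/-- The lower bound `x'' ≥ c q`, with `q` not integrable, drives `x'` to infinity. -/
theorem tendsto_deriv_atTop (h : PositiveFeedback q τ s Δ P x) (hq : AEMeasurable q)
    (hint : ∀ T, ∫⁻ t in Ioi T, ENNReal.ofReal (q t) = ⊤) {T c : ℝ} (hT : s < T) (hΔ : 0 ≤ Δ)
    (hc : 0 < c) (hpos : ∀ t, T ≤ t → c ≤ x t) : Tendsto (deriv x) atTop atTop := by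
  have hmono := h.monotoneOn_deriv hT hΔ fun t ht => hc.le.trans (hpos t ht)
  set a := T + Δ with ha
  by_contra hcon
  have hbdd : ∃ B, ∀ t, a ≤ t → deriv x t ≤ B := by
    by_contra hB
    push Not at hB
    refine hcon (tendsto_atTop.2 fun B => ?_)
    obtain ⟨t, hat, ht⟩ := hB B
    filter_upwards [eventually_ge_atTop t] with r hr
    exact ht.le.trans (hmono hat (hat.trans hr) hr)
  obtain ⟨B, hB⟩ := hbdd
  have hloc : ∀ u v : ℝ, IntervalIntegrable q volume u v := by
    intro u v
    rw [intervalIntegrable_iff]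
    refine Measure.integrableOn_of_bounded (M := P) (by simp) hq.aestronglyMeasurable ?_
    refine ae_restrict_of_ae ?_
    filter_upwards [h.coeff_le] with t ht
    rwa [Real.norm_eq_abs, abs_of_nonneg (h.coeff_nonneg t)]
  have hbound : ∀ b, a ≤ b → ∫ t in a..b, ‖q t‖ ≤ (B - deriv x a) / c := by
    intro b hab
    rw [le_div_iff₀ hc]
    have hac := h.absCont a b (by linarith) hab
    have h1 := hac.integral_deriv_eq_sub
    have h2 : ∫ t in a..b, q t * c ≤ ∫ t in a..b, deriv (deriv x) t := by
      refine intervalIntegral.integral_mono_ae_restrict hab ((hloc a b).mul_const c)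
        hac.intervalIntegrable_deriv ?_
      rw [EventuallyLE, ae_restrict_iff' measurableSet_Icc]
      filter_upwards [h.equation, h.delay_le] with t h3 h4 ht
      have hst : s < t := by linarith [ht.1]
      rw [(h3 hst).deriv]
      exact mul_le_mul_of_nonneg_left (hpos _ (by linarith [ht.1, h4 hst])) (h.coeff_nonneg t)
    have h5 : ∫ t in a..b, ‖q t‖ = ∫ t in a..b, q t := by
      refine intervalIntegral.integral_congr fun t _ => ?_
      exact abs_of_nonneg (h.coeff_nonneg t)
    rw [intervalIntegral.integral_mul_const] at h2
    rw [h5]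
    linarith [hB b hab]
  have hon : IntegrableOn q (Ioi a) :=
    integrableOn_Ioi_of_intervalIntegral_norm_bounded _ a
      (fun b => ((hloc a b).1)) tendsto_id
      (by filter_upwards [eventually_ge_atTop a] with b hb using hbound b hb)
  have := hon.2
  rw [hasFiniteIntegral_iff_ofReal (ae_of_all _ h.coeff_nonneg), hint a] at this
  exact lt_irrefl _ this

/-- An eventually positive solution is eventually convex; it goes to infinity if its derivative
becomes positive, and decreases to zero otherwise. -/
theorem of_eventually_pos (h : PositiveFeedback q τ s Δ P x) (hq : AEMeasurable q)
    (hint : ∀ T, ∫⁻ t in Ioi T, ENNReal.ofReal (q t) = ⊤) (hΔ : 0 ≤ Δ)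
    (hpos : ∀ᶠ t in atTop, 0 < x t) :
    (Tendsto x atTop atTop ∧ Tendsto (deriv x) atTop atTop) ∨
      ((∃ T, AntitoneOn x (Ici T)) ∧ Tendsto x atTop (𝓝 0) ∧ Tendsto (deriv x) atTop (𝓝 0)) := by
  obtain ⟨T₀, hT₀⟩ := eventually_atTop.1 (hpos.and (eventually_gt_atTop s))
  have hsT : s < T₀ := (hT₀ T₀ le_rfl).2
  have hmono := h.monotoneOn_deriv hsT hΔ fun t ht => (hT₀ t ht).1.le
  set T := T₀ + Δ with hT
  have hder : ∀ t ∈ Ici T, HasDerivAt x (deriv x t) t := fun t ht =>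
    h.hasDerivAt t (by linarith [mem_Ici.1 ht])
  have hlin : ∀ u v c : ℝ, T ≤ u → u ≤ v → (∀ r ∈ Icc u v, c ≤ deriv x r) →
      x u + c * (v - u) ≤ x v := by
    intro u v c hu huv hc
    have := (convex_Icc u v).mul_sub_le_image_sub_of_le_deriv
      (fun r hr => (hder r (hu.trans hr.1)).continuousAt.continuousWithinAt)
      (fun r hr => (hder r (hu.trans
        (interior_subset hr).1)).differentiableAt.differentiableWithinAt)
      (fun r hr => hc r (interior_subset hr)) u (left_mem_Icc.2 huv) v (right_mem_Icc.2 huv) huv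
    linarith
  have hlin' : ∀ u v c : ℝ, T ≤ u → u ≤ v → (∀ r ∈ Icc u v, deriv x r ≤ c) →
      x v ≤ x u + c * (v - u) := by
    intro u v c hu huv hc
    have := (convex_Icc u v).image_sub_le_mul_sub_of_deriv_le
      (fun r hr => (hder r (hu.trans hr.1)).continuousAt.continuousWithinAt)
      (fun r hr => (hder r (hu.trans
        (interior_subset hr).1)).differentiableAt.differentiableWithinAt)
      (fun r hr => hc r (interior_subset hr)) u (left_mem_Icc.2 huv) v (right_mem_Icc.2 huv) huv
    linarith
  by_cases hcase : ∃ t, T ≤ t ∧ 0 < deriv x t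
  · left
    obtain ⟨t, hTt, hdt⟩ := hcase
    have hge : ∀ v, t ≤ v → x t + deriv x t * (v - t) ≤ x v := fun v hv =>
      hlin t v _ hTt hv fun r hr => hmono hTt (hTt.trans hr.1) hr.1
    refine ⟨?_, h.tendsto_deriv_atTop hq hint (T := t) (c := x t) (by linarith) hΔ
      (hT₀ t (by linarith)).1 fun v hv => ?_⟩
    · refine tendsto_atTop_mono' atTop
        (f₁ := fun v => x t + deriv x t * (v - t)) ?_ ?_
      · filter_upwards [eventually_ge_atTop t] with v hv using hge v hv
      · refine tendsto_atTop_add_const_left _ _ (Tendsto.const_mul_atTop hdt ?_)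
        exact tendsto_atTop_add_const_right _ _ tendsto_id
    · have := hge v hv
      have := mul_nonneg hdt.le (sub_nonneg.2 hv)
      linarith
  · right
    push Not at hcase
    have hanti : AntitoneOn x (Ici T) := by
      intro u hu v hv huv
      have := hlin' u v 0 hu huv fun r hr => hcase r (le_trans hu hr.1)
      linarith
    refine ⟨⟨T, hanti⟩, ?_, ?_⟩
    · rw [Metric.tendsto_atTop]
      intro ε hε
      by_contra hcon
      push Not at hcon
      have hge : ∀ t, T ≤ t → ε ≤ x t := by
        intro t ht
        obtain ⟨r, hr, hr'⟩ := hcon t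
        rw [Real.dist_eq, sub_zero, abs_of_pos (hT₀ r (by linarith)).1] at hr'
        exact hr'.trans (hanti ht (ht.trans hr) hr)
      have hlim := h.tendsto_deriv_atTop hq hint (T := T) (by linarith) hΔ hε hge
      obtain ⟨r, hr1, hr2⟩ := ((hlim.eventually_gt_atTop 0).and (eventually_ge_atTop T)).exists
      exact absurd hr1 (not_lt.2 (hcase r hr2))
    · rw [Metric.tendsto_atTop]
      intro ε hε
      by_contra hcon
      push Not at hcon
      have hle : ∀ t, T ≤ t → deriv x t ≤ -ε := by
        intro t ht
        obtain ⟨r, hr, hr'⟩ := hcon t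
        rw [Real.dist_eq, sub_zero, abs_of_nonpos (hcase r (ht.trans hr))] at hr'
        have := hmono (show t ∈ Ici T from ht) (show r ∈ Ici T from ht.trans hr) hr
        linarith
      have hxT := (hT₀ T (by linarith)).1
      have hv : T ≤ T + x T / ε := by
        have := div_pos hxT hε
        linarith
      have h1 := hlin' T (T + x T / ε) (-ε) le_rfl hv fun r hr => hle r hr.1
      have h2 : -ε * (T + x T / ε - T) = -x T := by
        field_simp
        ring
      have h3 := (hT₀ (T + x T / ε) (by linarith)).1
      linarith

/-- The four asymptotic behaviours are the only ones. -/
theorem exists_asymptoticBehavior (h : PositiveFeedback q τ s Δ P x) (hq : AEMeasurable q)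
    (hint : ∀ T, ∫⁻ t in Ioi T, ENNReal.ofReal (q t) = ⊤) (hP : 0 < P) (hΔ : 0 ≤ Δ)
    (hPΔ : Δ * √P ≤ Real.pi / 2) : ∃ k : AsymptoticBehavior, k.Holds x := by
  by_cases hosc : Oscillatory x
  · exact ⟨.oscillatoryDecay, hosc, h.tendsto_zero_of_oscillatory hosc hP hΔ hPΔ⟩
  have hosc' := hosc
  unfold Oscillatory at hosc'
  push Not at hosc'
  obtain ⟨T, hT⟩ := hosc'
  have hcont : ContinuousOn x (Ici (max T (s + 1))) :=
    h.continuousOn.mono fun t ht => mem_Ioi.2 (by linarith [le_max_right T (s + 1), mem_Ici.1 ht])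
  have hne : ∀ t ∈ Ici (max T (s + 1)), x t ≠ 0 := fun t ht =>
    hT t ((le_max_left _ _).trans ht)
  have hsign : (∀ t ∈ Ici (max T (s + 1)), 0 < x t) ∨ ∀ t ∈ Ici (max T (s + 1)), x t < 0 := by
    by_contra hcon
    push Not at hcon
    obtain ⟨⟨u, hu, hu'⟩, v, hv, hv'⟩ := hcon
    obtain ⟨c, hc, hc0⟩ := isPreconnected_Ici.intermediate_value hu hv hcont ⟨hu', hv'⟩
    exact hne c hc hc0
  rcases hsign with hs | hs
  · rcases h.of_eventually_pos hq hint hΔ (by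
      filter_upwards [eventually_ge_atTop (max T (s + 1))] with t ht using hs t ht) with h1 | h1
    · exact ⟨.toPosInfinity, h1⟩
    · exact ⟨.monotoneDecay, hosc, h1.1.imp fun _ => Or.inr, h1.2⟩
  · have e : deriv (fun t => -x t) = fun t => -deriv x t := by
      funext t
      exact deriv.fun_neg
    rcases h.neg.of_eventually_pos hq hint hΔ (by
      filter_upwards [eventually_ge_atTop (max T (s + 1))] with t ht
        using neg_pos.2 (hs t ht)) with h1 | h1
    · rw [e] at h1
      exact ⟨.toNegInfinity, tendsto_neg_atTop_iff.1 h1.1, tendsto_neg_atTop_iff.1 h1.2⟩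
    · rw [e] at h1
      refine ⟨.monotoneDecay, hosc, h1.1.imp fun T hT => Or.inl fun u hu v hv huv => ?_, ?_, ?_⟩
      · exact neg_le_neg_iff.1 (hT hu hv huv)
      · simpa using h1.2.1.neg
      · simpa using h1.2.2.neg

end PositiveFeedback

/-- The four asymptotic behaviours exclude each other. -/
theorem AsymptoticBehavior.Holds.unique {x : ℝ → ℝ} {k l : AsymptoticBehavior} (hk : k.Holds x)
    (hl : l.Holds x) : k = l := by
  have h1 : Tendsto x atTop (𝓝 0) → ¬ Tendsto x atTop atTop := fun h0 =>
    not_tendsto_atTop_of_tendsto_nhds h0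
  have h2 : Tendsto x atTop (𝓝 0) → ¬ Tendsto x atTop atBot := fun h0 =>
    not_tendsto_atBot_of_tendsto_nhds h0
  have h3 : Tendsto x atTop atTop → ¬ Tendsto x atTop atBot := fun h0 h4 =>
    h0.not_tendsto disjoint_atTop_atBot h4
  cases k <;> cases l <;> simp only [AsymptoticBehavior.Holds] at hk hl <;> tauto

/-! ### A positive bounded solution -/

/-- Data for the construction of a decaying solution: `k(t) = q(t) exp (ν τ(t))` is the coefficient
of the delayed term in the equation for `X(t) = exp (ν t) x(t)`. That `k` vanishes before
`s₀ + Δ` makes the values of `X` before `s₀` irrelevant. -/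
structure DecayData (ν s₀ Δ : ℝ) (k τ : ℝ → ℝ) : Prop where
  rate_pos : 0 < ν
  measurable_coeff : Measurable k
  measurable_delay : Measurable τ
  coeff_nonneg : ∀ t, 0 ≤ k t
  coeff_le : ∀ t, k t ≤ ν ^ 2
  coeff_eq_zero : ∀ t, t < s₀ + Δ → k t = 0
  delay_nonneg : ∀ t, 0 ≤ τ t
  delay_le : ∀ t, τ t ≤ Δ

/-- The functions on which the iteration takes place: `0 ≤ X(t) ≤ exp (ν t)` for `t ≥ s₀`. -/
structure DecayAdmissible (ν s₀ : ℝ) (X : ℝ → ℝ) : Prop where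
  measurable : Measurable X
  nonneg : ∀ t, s₀ ≤ t → 0 ≤ X t
  le_exp : ∀ t, s₀ ≤ t → X t ≤ Real.exp (ν * t)

/-- The function `exp (-2 ν r) (ν² X(r) - k(r) X(r - τ(r)))` on `[s₀, ∞)`, extended by zero. -/
noncomputable def decayDefect (ν s₀ : ℝ) (k τ X : ℝ → ℝ) : ℝ → ℝ :=
  (Ici s₀).indicator fun r => Real.exp (-(2 * ν) * r) * (ν ^ 2 * X r - k r * X (r - τ r))

/-- The derivative of `decayPrimitive`. -/
noncomputable def decayVelocity (ν s₀ : ℝ) (k τ X : ℝ → ℝ) (t : ℝ) : ℝ :=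
  Real.exp (2 * ν * t) * ∫ r in Ioi t, decayDefect ν s₀ k τ X r

/-- The linear operator whose fixed point equation `X = X(s₀) + decayPrimitive X` is the delay
equation for `x(t) = exp (-ν t) X(t)`. -/
noncomputable def decayPrimitive (ν s₀ : ℝ) (k τ X : ℝ → ℝ) (t : ℝ) : ℝ :=
  ∫ r in s₀..t, decayVelocity ν s₀ k τ X r

namespace DecayData

variable {ν s₀ Δ : ℝ} {k τ X Y : ℝ → ℝ}

theorem exp_decomp (ν r : ℝ) :
    Real.exp (-(2 * ν) * r) * Real.exp (ν * r) = Real.exp (-ν * r) := by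
  rw [← Real.exp_add]
  ring_nf

theorem coeff_mul_mem (h : DecayData ν s₀ Δ k τ) (hX : DecayAdmissible ν s₀ X) (r : ℝ) :
    0 ≤ k r * X (r - τ r) ∧ k r * X (r - τ r) ≤ ν ^ 2 * Real.exp (ν * r) := by
  rcases lt_or_ge r (s₀ + Δ) with h1 | h1
  · rw [h.coeff_eq_zero r h1]
    simp only [zero_mul, le_refl, true_and]
    positivity
  · have h2 : s₀ ≤ r - τ r := by linarith [h.delay_le r]
    have h3 := hX.nonneg _ h2
    have h4 : X (r - τ r) ≤ Real.exp (ν * r) := by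
      refine (hX.le_exp _ h2).trans (Real.exp_le_exp.2 ?_)
      nlinarith [h.delay_nonneg r, h.rate_pos]
    exact ⟨mul_nonneg (h.coeff_nonneg r) h3,
      mul_le_mul (h.coeff_le r) h4 h3 (sq_nonneg _)⟩

theorem measurable_defect (h : DecayData ν s₀ Δ k τ) (hX : Measurable X) :
    Measurable (decayDefect ν s₀ k τ X) := by
  have h1 := h.measurable_coeff
  have h2 := h.measurable_delay
  have h3 : Measurable fun r => X (r - τ r) := hX.comp (measurable_id.sub h2)
  refine Measurable.indicator ?_ measurableSet_Ici
  fun_prop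

theorem norm_defect_le (h : DecayData ν s₀ Δ k τ) (hX : DecayAdmissible ν s₀ X) (r : ℝ) :
    ‖decayDefect ν s₀ k τ X r‖ ≤ ν ^ 2 * Real.exp (-ν * r) := by
  rw [decayDefect]
  by_cases hr : r ∈ Ici s₀
  · rw [indicator_of_mem hr, norm_mul, Real.norm_eq_abs, abs_of_pos (Real.exp_pos _),
      ← exp_decomp ν r, mul_left_comm]
    refine mul_le_mul_of_nonneg_left ?_ (Real.exp_pos _).le
    have h1 := h.coeff_mul_mem hX r
    have h2 := mul_nonneg (sq_nonneg ν) (hX.nonneg r hr)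
    have h3 := mul_le_mul_of_nonneg_left (hX.le_exp r hr) (sq_nonneg ν)
    rw [Real.norm_eq_abs, abs_le]
    constructor <;> linarith
  · rw [indicator_of_notMem hr, norm_zero]
    positivity

theorem integrableOn_bound (h : DecayData ν s₀ Δ k τ) (t : ℝ) :
    IntegrableOn (fun r => ν ^ 2 * Real.exp (-ν * r)) (Ioi t) :=
  (integrableOn_exp_mul_Ioi (neg_neg_iff_pos.2 h.rate_pos) t).const_mul _

theorem integral_bound (h : DecayData ν s₀ Δ k τ) (t : ℝ) :
    ∫ r in Ioi t, ν ^ 2 * Real.exp (-ν * r) = ν * Real.exp (-ν * t) := by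
  have := h.rate_pos
  rw [integral_const_mul, integral_exp_mul_Ioi (neg_neg_iff_pos.2 h.rate_pos)]
  field_simp

theorem integrableOn_defect (h : DecayData ν s₀ Δ k τ) (hX : DecayAdmissible ν s₀ X) (t : ℝ) :
    IntegrableOn (decayDefect ν s₀ k τ X) (Ioi t) :=
  (h.integrableOn_bound t).mono' (h.measurable_defect hX.measurable).aestronglyMeasurable
    (ae_of_all _ (h.norm_defect_le hX))

theorem intervalIntegrable_defect (h : DecayData ν s₀ Δ k τ) (hX : DecayAdmissible ν s₀ X)
    (u v : ℝ) : IntervalIntegrable (decayDefect ν s₀ k τ X) volume u v := by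
  rw [intervalIntegrable_iff]
  exact (h.integrableOn_defect hX (min u v)).mono_set fun r hr => hr.1

theorem integral_Ioi_defect (h : DecayData ν s₀ Δ k τ) (hX : DecayAdmissible ν s₀ X) (t : ℝ) :
    ∫ r in Ioi t, decayDefect ν s₀ k τ X r =
      (∫ r in Ioi s₀, decayDefect ν s₀ k τ X r) - ∫ r in s₀..t, decayDefect ν s₀ k τ X r := by
  rw [← intervalIntegral.integral_interval_add_Ioi (h.integrableOn_defect hX s₀)
    (h.integrableOn_defect hX t)]
  ring

theorem continuous_velocity (h : DecayData ν s₀ Δ k τ) (hX : DecayAdmissible ν s₀ X) :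
    Continuous (decayVelocity ν s₀ k τ X) := by
  have h1 : Continuous fun t => ∫ r in s₀..t, decayDefect ν s₀ k τ X r :=
    intervalIntegral.continuous_primitive (h.intervalIntegrable_defect hX) s₀
  have h2 : decayVelocity ν s₀ k τ X = fun t => Real.exp (2 * ν * t) *
      ((∫ r in Ioi s₀, decayDefect ν s₀ k τ X r) - ∫ r in s₀..t, decayDefect ν s₀ k τ X r) := by
    funext t
    rw [decayVelocity, h.integral_Ioi_defect hX]
  rw [h2]
  fun_prop

theorem norm_velocity_le (h : DecayData ν s₀ Δ k τ) (hX : DecayAdmissible ν s₀ X) (t : ℝ) :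
    ‖decayVelocity ν s₀ k τ X t‖ ≤ ν * Real.exp (ν * t) := by
  have h1 : ‖∫ r in Ioi t, decayDefect ν s₀ k τ X r‖ ≤ ν * Real.exp (-ν * t) := by
    rw [← h.integral_bound t]
    exact norm_integral_le_of_norm_le (h.integrableOn_bound t) (ae_of_all _ (h.norm_defect_le hX))
  rw [decayVelocity, norm_mul, Real.norm_eq_abs (Real.exp _), abs_of_pos (Real.exp_pos _)]
  have h2 : Real.exp (2 * ν * t) * (ν * Real.exp (-ν * t)) = ν * Real.exp (ν * t) := by
    rw [mul_left_comm, ← Real.exp_add]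
    ring_nf
  rw [← h2]
  exact mul_le_mul_of_nonneg_left h1 (Real.exp_pos _).le

theorem hasDerivAt_primitive (h : DecayData ν s₀ Δ k τ) (hX : DecayAdmissible ν s₀ X) (t : ℝ) :
    HasDerivAt (decayPrimitive ν s₀ k τ X) (decayVelocity ν s₀ k τ X t) t :=
  intervalIntegral.integral_hasDerivAt_right ((h.continuous_velocity hX).intervalIntegrable _ _)
    ((h.continuous_velocity hX).stronglyMeasurableAtFilter _ _) (h.continuous_velocity hX).continuousAt

theorem continuous_primitive (h : DecayData ν s₀ Δ k τ) (hX : DecayAdmissible ν s₀ X) :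
    Continuous (decayPrimitive ν s₀ k τ X) :=
  continuous_iff_continuousAt.2 fun t => (h.hasDerivAt_primitive hX t).continuousAt

theorem velocity_mono (h : DecayData ν s₀ Δ k τ) (hX : DecayAdmissible ν s₀ X)
    (hY : DecayAdmissible ν s₀ Y) (hmono : MonotoneOn (fun t => Y t - X t) (Ici s₀))
    (h0 : X s₀ ≤ Y s₀) (t : ℝ) : decayVelocity ν s₀ k τ X t ≤ decayVelocity ν s₀ k τ Y t := by
  refine mul_le_mul_of_nonneg_left ?_ (Real.exp_pos _).le
  refine setIntegral_mono (h.integrableOn_defect hX t) (h.integrableOn_defect hY t) fun r => ?_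
  rw [decayDefect, decayDefect]
  by_cases hr : r ∈ Ici s₀
  · rw [indicator_of_mem hr, indicator_of_mem hr]
    refine mul_le_mul_of_nonneg_left ?_ (Real.exp_pos _).le
    have h1 := hmono self_mem_Ici hr hr
    beta_reduce at h1
    -- the difference `D = Y - X` is nonnegative and nondecreasing and `k ≤ ν²`, so that
    -- `ν² D(r) - k(r) D(r - τ(r)) ≥ 0`
    have key : k r * (Y (r - τ r) - X (r - τ r)) ≤ ν ^ 2 * (Y r - X r) := by
      rcases lt_or_ge r (s₀ + Δ) with h2 | h2
      · rw [h.coeff_eq_zero r h2, zero_mul]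
        exact mul_nonneg (sq_nonneg _) (by linarith)
      · have h3 : s₀ ≤ r - τ r := by linarith [h.delay_le r]
        have h4 := hmono self_mem_Ici (show r - τ r ∈ Ici s₀ from h3) h3
        have h5 := hmono (show r - τ r ∈ Ici s₀ from h3) hr (by linarith [h.delay_nonneg r])
        beta_reduce at h4 h5
        exact mul_le_mul (h.coeff_le r) h5 (by linarith) (sq_nonneg _)
    linarith
  · rw [indicator_of_notMem hr, indicator_of_notMem hr]

/-- On the cone of nonnegative nondecreasing functions the operator is positive. -/
theorem primitive_sub_monotoneOn (h : DecayData ν s₀ Δ k τ) (hX : DecayAdmissible ν s₀ X)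
    (hY : DecayAdmissible ν s₀ Y) (hmono : MonotoneOn (fun t => Y t - X t) (Ici s₀))
    (h0 : X s₀ ≤ Y s₀) :
    MonotoneOn (fun t => decayPrimitive ν s₀ k τ Y t - decayPrimitive ν s₀ k τ X t) (Ici s₀) := by
  refine (monotone_of_deriv_nonneg (fun t => ((h.hasDerivAt_primitive hY t).fun_sub
    (h.hasDerivAt_primitive hX t)).differentiableAt) fun t => ?_).monotoneOn _
  rw [((h.hasDerivAt_primitive hY t).fun_sub (h.hasDerivAt_primitive hX t)).deriv]
  exact sub_nonneg.2 (h.velocity_mono hX hY hmono h0 t)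

theorem exp_sub_primitive_monotone (h : DecayData ν s₀ Δ k τ) (hX : DecayAdmissible ν s₀ X) :
    Monotone (fun t => Real.exp (ν * t) - decayPrimitive ν s₀ k τ X t) := by
  have hd : ∀ t, HasDerivAt (fun t => Real.exp (ν * t) - decayPrimitive ν s₀ k τ X t)
      (Real.exp (ν * t) * ν - decayVelocity ν s₀ k τ X t) t := fun t => by
    have h1 : HasDerivAt (fun t => ν * t) ν t := by simpa using (hasDerivAt_id t).const_mul ν
    exact h1.exp.fun_sub (h.hasDerivAt_primitive hX t)
  refine monotone_of_deriv_nonneg (fun t => (hd t).differentiableAt) fun t => ?_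
  rw [(hd t).deriv]
  have := (abs_le.1 (h.norm_velocity_le hX t)).2
  linarith

/-- The iterates, started at zero. -/
noncomputable def iterate (ν s₀ : ℝ) (k τ : ℝ → ℝ) : ℕ → ℝ → ℝ
  | 0 => fun _ => 0
  | n + 1 => fun t => Real.exp (ν * s₀) + decayPrimitive ν s₀ k τ (iterate ν s₀ k τ n) t

theorem primitive_start (X : ℝ → ℝ) : decayPrimitive ν s₀ k τ X s₀ = 0 :=
  intervalIntegral.integral_same

theorem primitive_zero : decayPrimitive ν s₀ k τ (fun _ => 0) = fun _ => 0 := by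
  funext t
  have h1 : decayDefect ν s₀ k τ (fun _ => 0) = fun _ => 0 := by
    funext r
    simp [decayDefect]
  have h2 : decayVelocity ν s₀ k τ (fun _ => 0) = fun _ => 0 := by
    funext r
    simp [decayVelocity, h1]
  simp [decayPrimitive, h2]

/-- The iterates are admissible and their increments lie in the cone of nonnegative nondecreasing
functions. The upper bound `exp (ν t)` persists since it exceeds its own image under the iteration
step by a function of that cone. -/
theorem iterate_spec (h : DecayData ν s₀ Δ k τ) (n : ℕ) :
    DecayAdmissible ν s₀ (iterate ν s₀ k τ n) ∧
    DecayAdmissible ν s₀ (iterate ν s₀ k τ (n + 1)) ∧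
    MonotoneOn (fun t => iterate ν s₀ k τ (n + 1) t - iterate ν s₀ k τ n t) (Ici s₀) ∧
    iterate ν s₀ k τ n s₀ ≤ iterate ν s₀ k τ (n + 1) s₀ := by
  have hbound : ∀ X, DecayAdmissible ν s₀ X → ∀ t, s₀ ≤ t →
      Real.exp (ν * s₀) + decayPrimitive ν s₀ k τ X t ≤ Real.exp (ν * t) := by
    intro X hX t ht
    have := h.exp_sub_primitive_monotone hX ht
    beta_reduce at this
    rw [primitive_start] at this
    linarith
  induction n with
  | zero =>
    have h0 : DecayAdmissible ν s₀ (iterate ν s₀ k τ 0) :=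
      ⟨measurable_const, fun _ _ => le_rfl, fun _ _ => (Real.exp_pos _).le⟩
    have e : iterate ν s₀ k τ 1 = fun _ => Real.exp (ν * s₀) := by
      funext t
      simp only [iterate, primitive_zero, add_zero]
    refine ⟨h0, ?_, ?_, ?_⟩
    · rw [zero_add, e]
      refine ⟨measurable_const, fun _ _ => (Real.exp_pos _).le, fun t ht => ?_⟩
      exact Real.exp_le_exp.2 (mul_le_mul_of_nonneg_left ht h.rate_pos.le)
    · rw [zero_add, e]
      exact fun _ _ _ _ _ => le_rfl
    · rw [zero_add, e]
      exact (Real.exp_pos _).le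
  | succ n ih =>
    obtain ⟨h1, h2, h3, h4⟩ := ih
    have h5 : MonotoneOn (fun t => iterate ν s₀ k τ (n + 1 + 1) t - iterate ν s₀ k τ (n + 1) t)
        (Ici s₀) := by
      have := h.primitive_sub_monotoneOn h1 h2 h3 h4
      simpa only [iterate, add_sub_add_left_eq_sub] using this
    have h6 : iterate ν s₀ k τ (n + 1) s₀ ≤ iterate ν s₀ k τ (n + 1 + 1) s₀ := by
      simp only [iterate, primitive_start, le_refl]
    refine ⟨h2, ⟨?_, fun t ht => ?_, fun t ht => hbound _ h2 t ht⟩, h5, h6⟩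
    · exact ((h.continuous_primitive h2).measurable.const_add _)
    · have h7 := h5 self_mem_Ici (show t ∈ Ici s₀ from ht) ht
      have h8 := h2.nonneg t ht
      beta_reduce at h7
      linarith

/-- The limit of the iterates is a fixed point. -/
theorem exists_fixedPoint (h : DecayData ν s₀ Δ k τ) :
    ∃ X, DecayAdmissible ν s₀ X ∧ ∀ t, s₀ ≤ t →
      X t = Real.exp (ν * s₀) + decayPrimitive ν s₀ k τ X t ∧ Real.exp (ν * s₀) ≤ X t := by
  have hadm := fun n => (h.iterate_spec n).1
  have hstep : ∀ t, s₀ ≤ t → ∀ n, iterate ν s₀ k τ n t ≤ iterate ν s₀ k τ (n + 1) t := by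
    intro t ht n
    obtain ⟨-, -, h3, h4⟩ := h.iterate_spec n
    have h5 := h3 self_mem_Ici (show t ∈ Ici s₀ from ht) ht
    beta_reduce at h5
    linarith
  have hlim : ∀ t, ∃ l, Tendsto (fun n => (Ici s₀).indicator (iterate ν s₀ k τ n) t) atTop
      (𝓝 l) := by
    intro t
    by_cases ht : t ∈ Ici s₀
    · simp only [indicator_of_mem ht]
      exact ⟨_, tendsto_atTop_ciSup (monotone_nat_of_le_succ (hstep t ht))
        ⟨Real.exp (ν * t), by rintro _ ⟨n, rfl⟩; exact (hadm n).le_exp t ht⟩⟩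
    · simp only [indicator_of_notMem ht]
      exact ⟨0, tendsto_const_nhds⟩
  choose X hX using hlim
  have hX' : ∀ t, s₀ ≤ t → Tendsto (fun n => iterate ν s₀ k τ n t) atTop (𝓝 (X t)) := by
    intro t ht
    have := hX t
    simpa only [indicator_of_mem (show t ∈ Ici s₀ from ht)] using this
  have hXadm : DecayAdmissible ν s₀ X := by
    refine ⟨measurable_of_tendsto_metrizable
      (fun n => (hadm n).measurable.indicator measurableSet_Ici) (tendsto_pi_nhds.2 hX),
      fun t ht => ?_, fun t ht => ?_⟩
    · exact ge_of_tendsto' (hX' t ht) fun n => (hadm n).nonneg t ht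
    · exact le_of_tendsto' (hX' t ht) fun n => (hadm n).le_exp t ht
  have hdefect : ∀ r, Tendsto (fun n => decayDefect ν s₀ k τ (iterate ν s₀ k τ n) r) atTop
      (𝓝 (decayDefect ν s₀ k τ X r)) := by
    intro r
    simp only [decayDefect]
    by_cases hr : r ∈ Ici s₀
    · simp only [indicator_of_mem hr]
      refine Tendsto.const_mul _ (((hX' r hr).const_mul _).sub ?_)
      rcases lt_or_ge r (s₀ + Δ) with h2 | h2
      · simp only [h.coeff_eq_zero r h2, zero_mul]
        exact tendsto_const_nhds
      · exact (hX' _ (by linarith [h.delay_le r])).const_mul _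
    · simp only [indicator_of_notMem hr]
      exact tendsto_const_nhds
  have hvel : ∀ t, Tendsto (fun n => decayVelocity ν s₀ k τ (iterate ν s₀ k τ n) t) atTop
      (𝓝 (decayVelocity ν s₀ k τ X t)) := by
    intro t
    refine Tendsto.const_mul _ (tendsto_integral_of_dominated_convergence
      (fun r => ν ^ 2 * Real.exp (-ν * r))
      (fun n => (h.measurable_defect (hadm n).measurable).aestronglyMeasurable)
      (h.integrableOn_bound t) (fun n => ae_of_all _ (h.norm_defect_le (hadm n)))
      (ae_of_all _ hdefect))
  have hprim : ∀ t, Tendsto (fun n => decayPrimitive ν s₀ k τ (iterate ν s₀ k τ n) t) atTop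
      (𝓝 (decayPrimitive ν s₀ k τ X t)) := by
    intro t
    refine intervalIntegral.tendsto_integral_filter_of_dominated_convergence
      (fun r => ν * Real.exp (ν * r))
      (Eventually.of_forall fun n => (h.continuous_velocity (hadm n)).aestronglyMeasurable)
      (Eventually.of_forall fun n => ae_of_all _ fun r _ => h.norm_velocity_le (hadm n) r)
      (Continuous.intervalIntegrable (by fun_prop) _ _) (ae_of_all _ fun r _ => hvel r)
  refine ⟨X, hXadm, fun t ht => ⟨?_, ?_⟩⟩
  · refine tendsto_nhds_unique ((hX' t ht).comp (tendsto_add_atTop_nat 1)) ?_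
    exact (hprim t).const_add _
  · have h1 : iterate ν s₀ k τ 1 t = Real.exp (ν * s₀) := by
      simp only [iterate, primitive_zero, add_zero]
    rw [← h1]
    exact (monotone_nat_of_le_succ (hstep t ht)).ge_of_tendsto (hX' t ht) 1

/-- The solution `x(t) = exp (-ν t) X(t)`, where `X` is the fixed point. -/
theorem exists_solution (h : DecayData ν s₀ Δ k τ) :
    ∃ x : ℝ → ℝ, Differentiable ℝ x ∧ (∀ a b, AbsolutelyContinuousOnInterval x a b) ∧
      (∀ a b, AbsolutelyContinuousOnInterval (deriv x) a b) ∧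
      (∀ᵐ t, s₀ + Δ ≤ t →
        HasDerivAt (deriv x) (k t * Real.exp (-ν * τ t) * x (t - τ t)) t) ∧
      ∀ t, s₀ ≤ t → 0 < x t ∧ x t ≤ 1 := by
  obtain ⟨X, hX, hfix⟩ := h.exists_fixedPoint
  set c := Real.exp (ν * s₀) with hc
  set J : ℝ → ℝ := fun t => ∫ r in Ioi t, decayDefect ν s₀ k τ X r with hJ
  set x : ℝ → ℝ := fun t => Real.exp (-ν * t) * (c + decayPrimitive ν s₀ k τ X t) with hx
  have hexp : ∀ (d t : ℝ), HasDerivAt (fun t => Real.exp (d * t)) (Real.exp (d * t) * d) t := by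
    intro d t
    have h1 : HasDerivAt (fun t => d * t) d t := by simpa using (hasDerivAt_id t).const_mul d
    exact h1.exp
  have hxd : ∀ t, HasDerivAt x (Real.exp (ν * t) * J t - ν * x t) t := by
    intro t
    refine ((hexp (-ν) t).fun_mul ((h.hasDerivAt_primitive hX t).const_add c)).congr_deriv ?_
    have h1 : Real.exp (-ν * t) * Real.exp (2 * ν * t) = Real.exp (ν * t) := by
      rw [← Real.exp_add]
      ring_nf
    rw [decayVelocity, ← h1]
    simp only [hx, hJ]
    ring
  have hderiv : deriv x = fun t => Real.exp (ν * t) * J t - ν * x t :=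
    funext fun t => (hxd t).deriv
  have hJeq : J = fun t => J s₀ - ∫ r in s₀..t, decayDefect ν s₀ k τ X r :=
    funext fun t => h.integral_Ioi_defect hX t
  have hJac : ∀ a b, AbsolutelyContinuousOnInterval J a b := by
    intro a b
    have h1 := (h.intervalIntegrable_defect hX (min a (min b s₀))
      (max a (max b s₀))).absolutelyContinuousOnInterval_intervalIntegral (c := s₀) (by
        rw [mem_uIcc]; left; simp)
    have h2 : AbsolutelyContinuousOnInterval
        (fun t => ∫ r in s₀..t, decayDefect ν s₀ k τ X r) a b := by
      refine h1.mono ?_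
      rw [uIcc_of_le (a := min a (min b s₀)) (by simp)]
      refine uIcc_subset_Icc ⟨?_, ?_⟩ ⟨?_, ?_⟩ <;> simp
    rw [hJeq]
    exact (ContDiffOn.absolutelyContinuousOnInterval contDiff_const.contDiffOn).fun_sub h2
  have hJcont : Continuous J := by
    rw [hJeq]
    exact continuous_const.sub
      (intervalIntegral.continuous_primitive (h.intervalIntegrable_defect hX) s₀)
  have hxdiff : Differentiable ℝ x := fun t => (hxd t).differentiableAt
  have hxac : ∀ a b, AbsolutelyContinuousOnInterval x a b := by
    intro a b
    refine ContDiffOn.absolutelyContinuousOnInterval (ContDiff.contDiffOn ?_)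
    rw [contDiff_one_iff_deriv, hderiv]
    refine ⟨hxdiff, ?_⟩
    have := hxdiff.continuous
    fun_prop
  have hxX : ∀ t, s₀ ≤ t → x t = Real.exp (-ν * t) * X t := fun t ht => by
    rw [(hfix t ht).1]
  refine ⟨x, hxdiff, hxac, fun a b => ?_, ?_, fun t ht => ?_⟩
  · rw [hderiv]
    refine (AbsolutelyContinuousOnInterval.mul ?_ (hJac a b)).fun_sub
      ((hxac a b).const_mul ν)
    refine ContDiffOn.absolutelyContinuousOnInterval (ContDiff.contDiffOn ?_)
    fun_prop
  · have hli : LocallyIntegrable (decayDefect ν s₀ k τ X) := by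
      intro t
      exact ⟨Ioi (t - 1), Ioi_mem_nhds (by linarith), h.integrableOn_defect hX (t - 1)⟩
    filter_upwards [LocallyIntegrable.ae_hasDerivAt_integral hli] with t ht hst
    have hJd : HasDerivAt J (-decayDefect ν s₀ k τ X t) t := by
      rw [hJeq]
      exact (ht s₀).const_sub _
    rw [hderiv]
    refine (((hexp ν t).fun_mul hJd).fun_sub ((hxd t).const_mul ν)).congr_deriv ?_
    have hΔ : 0 ≤ Δ := (h.delay_nonneg t).trans (h.delay_le t)
    have ht0 : s₀ ≤ t := by linarith
    have hτ : s₀ ≤ t - τ t := by linarith [h.delay_le t]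
    rw [decayDefect, indicator_of_mem (show t ∈ Ici s₀ from ht0), hxX t ht0, hxX _ hτ]
    have e1 : Real.exp (ν * t) * Real.exp (-(2 * ν) * t) = Real.exp (-ν * t) := by
      rw [← Real.exp_add]
      ring_nf
    have e2 : Real.exp (-ν * τ t) * Real.exp (-ν * (t - τ t)) = Real.exp (-ν * t) := by
      rw [← Real.exp_add]
      ring_nf
    linear_combination (-(ν ^ 2 * X t - k t * X (t - τ t))) * e1 - k t * X (t - τ t) * e2
  · rw [hxX t ht]
    refine ⟨mul_pos (Real.exp_pos _) ((Real.exp_pos _).trans_le (hfix t ht).2), ?_⟩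
    calc Real.exp (-ν * t) * X t ≤ Real.exp (-ν * t) * Real.exp (ν * t) :=
          mul_le_mul_of_nonneg_left (hX.le_exp t ht) (Real.exp_pos _).le
      _ = 1 := by
          rw [← Real.exp_add]
          simp

end DecayData

/-! ### A boundary value problem on `[0, ω]` -/

/-- The solution of `b'' = -F`, `b(0) = 0`, `b'(ω) = 0`, in terms of Green's function. For `u ≥ ω`
it has the constant value `∫₀^ω r F(r) dr`. -/
noncomputable def greenIntegral (F : ℝ → ℝ) (ω u : ℝ) : ℝ :=
  ∫ r in (0)..ω, min r u * F r

theorem greenIntegral_of_le {F : ℝ → ℝ} {ω u : ℝ} (hω : 0 ≤ ω) (hu : ω ≤ u) :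
    greenIntegral F ω u = ∫ r in (0)..ω, r * F r := by
  refine intervalIntegral.integral_congr fun r hr => ?_
  rw [uIcc_of_le hω] at hr
  simp only [min_eq_left (hr.2.trans hu)]

theorem greenIntegral_eq {F : ℝ → ℝ} (hF : Continuous F) {ω u : ℝ} (hu0 : 0 ≤ u) (huω : u ≤ ω) :
    greenIntegral F ω u = (∫ r in (0)..u, r * F r) + u * ∫ r in u..ω, F r := by
  have hi : ∀ a b, IntervalIntegrable (fun r => min r u * F r) volume a b :=
    fun a b => Continuous.intervalIntegrable (by fun_prop) a b
  rw [greenIntegral, ← intervalIntegral.integral_add_adjacent_intervals (hi 0 u) (hi u ω),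
    ← intervalIntegral.integral_const_mul]
  congr 1
  · refine intervalIntegral.integral_congr fun r hr => ?_
    rw [uIcc_of_le hu0] at hr
    simp only [min_eq_left hr.2]
  · refine intervalIntegral.integral_congr fun r hr => ?_
    rw [uIcc_of_le huω] at hr
    simp only [min_eq_right hr.1]

theorem greenIntegral_eq_one_sub {F : ℝ → ℝ} (hF : Continuous F) {ω u : ℝ}
    (h1 : ∫ r in (0)..ω, r * F r = 1) (hu0 : 0 ≤ u) (huω : u ≤ ω) :
    greenIntegral F ω u = 1 - ∫ r in u..ω, (r - u) * F r := by
  have hi : ∀ a b, IntervalIntegrable (fun r => r * F r) volume a b :=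
    fun a b => Continuous.intervalIntegrable (by fun_prop) a b
  have hi' : ∀ a b, IntervalIntegrable (fun r => u * F r) volume a b :=
    fun a b => Continuous.intervalIntegrable (by fun_prop) a b
  rw [greenIntegral_eq hF hu0 huω, ← h1,
    ← intervalIntegral.integral_add_adjacent_intervals (hi 0 u) (hi u ω)]
  simp only [sub_mul]
  rw [intervalIntegral.integral_sub (hi u ω) (hi' u ω), intervalIntegral.integral_const_mul]
  ring

theorem continuous_greenIntegral {F : ℝ → ℝ} {ω C : ℝ} (hF : Measurable F)
    (hC : ∀ r ∈ uIoc 0 ω, |F r| ≤ C) : Continuous (greenIntegral F ω) := by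
  rw [continuous_iff_continuousAt]
  intro u
  have hev : ∀ᶠ v in 𝓝 u, |v| < |u| + 1 :=
    (continuous_abs.tendsto u).eventually_lt_const (by linarith)
  refine intervalIntegral.continuousAt_of_dominated_interval
    (bound := fun r => (|r| + (|u| + 1)) * C) ?_ ?_
    (Continuous.intervalIntegrable (by fun_prop) _ _) ?_
  · exact Eventually.of_forall fun v => by
      have : Measurable fun r => min r v * F r := by fun_prop
      exact this.aestronglyMeasurable
  · filter_upwards [hev] with v hv
    refine ae_of_all _ fun r hr => ?_
    rw [norm_mul, Real.norm_eq_abs, Real.norm_eq_abs]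
    refine mul_le_mul ?_ (hC r hr) (abs_nonneg _) (by positivity)
    rcases min_choice r v with e | e <;> rw [e] <;> linarith [abs_nonneg r, abs_nonneg v]
  · exact ae_of_all _ fun r _ => by fun_prop

/-- The comparison principle: a larger right-hand side gives a shorter interval and a larger
solution. It holds since `min r u - r u / ω'` is nonnegative for `r ≤ ω'` and nonpositive for
`r ≥ ω'`, if `u ≤ ω'`. -/
theorem greenIntegral_comparison {F F' : ℝ → ℝ} (hF : Continuous F) (hF' : Continuous F')
    {ω ω' : ℝ} (hω : 0 < ω) (hω' : 0 < ω') (hF0 : ∀ r ∈ Icc 0 ω, 0 ≤ F r)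
    (hF'0 : ∀ r, 0 < r → 0 < F' r) (hle : ∀ r ∈ Icc 0 ω, F r ≤ F' r)
    (h1 : ∫ r in (0)..ω, r * F r = 1) (h1' : ∫ r in (0)..ω', r * F' r = 1) :
    ω' ≤ ω ∧ ∀ u, 0 ≤ u → greenIntegral F ω u ≤ greenIntegral F' ω' u := by
  have hlen : ω' ≤ ω := by
    by_contra hcon
    push Not at hcon
    have hi : ∀ a b, IntervalIntegrable (fun r => r * F' r) volume a b :=
      fun a b => Continuous.intervalIntegrable (by fun_prop) a b
    have h2 : ∫ r in (0)..ω, r * F r ≤ ∫ r in (0)..ω, r * F' r :=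
      intervalIntegral.integral_mono_on hω.le (Continuous.intervalIntegrable (by fun_prop) _ _)
        (hi _ _) fun r hr => mul_le_mul_of_nonneg_left (hle r hr) hr.1
    have h3 : 0 < ∫ r in ω..ω', r * F' r :=
      intervalIntegral.intervalIntegral_pos_of_pos_on (hi _ _)
        (fun r hr => mul_pos (hω.trans hr.1) (hF'0 r (hω.trans hr.1))) hcon
    have h4 := intervalIntegral.integral_add_adjacent_intervals (hi 0 ω) (hi ω ω')
    linarith
  refine ⟨hlen, fun u hu => ?_⟩
  rcases le_total ω' u with huω | huω
  · rw [greenIntegral_of_le hω'.le huω, h1', ← h1]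
    refine intervalIntegral.integral_mono_on hω.le
      (Continuous.intervalIntegrable (by fun_prop) _ _)
      (Continuous.intervalIntegrable (by fun_prop) _ _) fun r hr => ?_
    exact mul_le_mul_of_nonneg_right (min_le_left _ _) (hF0 r hr)
  · have hexp : ∀ (G : ℝ → ℝ) (η : ℝ), Continuous G → (∫ r in (0)..η, r * G r = 1) →
        ∫ r in (0)..η, (min r u - u / ω' * r) * G r = greenIntegral G η u - u / ω' := by
      intro G η hG hη
      have : ∀ r, (min r u - u / ω' * r) * G r = min r u * G r - u / ω' * (r * G r) :=
        fun r => by ring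
      simp only [this]
      rw [intervalIntegral.integral_sub (Continuous.intervalIntegrable (by fun_prop) _ _)
        (Continuous.intervalIntegrable (by fun_prop) _ _), intervalIntegral.integral_const_mul,
        hη, mul_one, greenIntegral]
    have hi : ∀ a b, IntervalIntegrable (fun r => (min r u - u / ω' * r) * F r) volume a b :=
      fun a b => Continuous.intervalIntegrable (by fun_prop) a b
    have hratio : u / ω' ≤ 1 := (div_le_one hω').2 huω
    have hratio0 : 0 ≤ u / ω' := by positivity
    have hu' : u / ω' * ω' = u := by field_simp
    have h2 : ∫ r in (0)..ω', (min r u - u / ω' * r) * F r ≤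
        ∫ r in (0)..ω', (min r u - u / ω' * r) * F' r := by
      refine intervalIntegral.integral_mono_on hω'.le (hi _ _)
        (Continuous.intervalIntegrable (by fun_prop) _ _) fun r hr => ?_
      refine mul_le_mul_of_nonneg_left (hle r ⟨hr.1, hr.2.trans hlen⟩) (sub_nonneg.2 ?_)
      refine le_min ?_ ?_
      · nlinarith [hr.1]
      · nlinarith [hr.2]
    have h3 : ∫ r in ω'..ω, (min r u - u / ω' * r) * F r ≤ 0 := by
      rw [← neg_nonneg, ← intervalIntegral.integral_neg]
      refine intervalIntegral.integral_nonneg hlen fun r hr => neg_nonneg.2 ?_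
      refine mul_nonpos_of_nonpos_of_nonneg ?_ (hF0 r ⟨hω'.le.trans hr.1, hr.2⟩)
      have := mul_le_mul_of_nonneg_left hr.1 hratio0
      linarith [min_le_right r u]
    have h4 := intervalIntegral.integral_add_adjacent_intervals (hi 0 ω') (hi ω' ω)
    rw [hexp F' ω' hF' h1'] at h2
    rw [hexp F ω hF h1] at h4
    linarith

theorem integral_sub_mul_sin (u : ℝ) :
    ∫ r in u..(Real.pi / 2), (r - u) * Real.sin r = 1 - Real.sin u := by
  rw [intervalIntegral.integral_eq_sub_of_hasDerivAt
    (f := fun r => -(r - u) * Real.cos r + Real.sin r) (fun r _ => ?_)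
    (Continuous.intervalIntegrable (by fun_prop) _ _)]
  · simp
  · refine ((((hasDerivAt_id r).sub_const u).neg.fun_mul (Real.hasDerivAt_cos r)).fun_add
      (Real.hasDerivAt_sin r)).congr_deriv ?_
    simp
    ring

theorem integral_sub_mul_cos (u T : ℝ) :
    ∫ r in u..T, (r - u) * Real.cos (T - r) = 1 - Real.cos (T - u) := by
  rw [intervalIntegral.integral_eq_sub_of_hasDerivAt
    (f := fun r => -(r - u) * Real.sin (T - r) + Real.cos (T - r)) (fun r _ => ?_)
    (Continuous.intervalIntegrable (by fun_prop) _ _)]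
  · simp
  · have h : HasDerivAt (fun r => T - r) (-1) r := by simpa using (hasDerivAt_id r).const_sub T
    refine ((((hasDerivAt_id r).sub_const u).neg.fun_mul h.sin).fun_add h.cos).congr_deriv ?_
    simp
    ring

theorem integral_mul_sin : ∫ r in (0)..(Real.pi / 2), r * Real.sin r = 1 := by
  simpa using integral_sub_mul_sin 0

theorem greenIntegral_sin {u : ℝ} (hu : 0 ≤ u) (hu' : u ≤ Real.pi / 2) :
    greenIntegral Real.sin (Real.pi / 2) u = Real.sin u := by
  rw [greenIntegral_eq_one_sub Real.continuous_sin integral_mul_sin hu hu', integral_sub_mul_sin]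
  ring

/-- A double integral over negative times, reflected to positive times. -/
theorem integral_integral_reflect {F Φ : ℝ → ℝ} (hF : Continuous F)
    (hΦ : ∀ v ≤ 0, Φ v = F (-v)) {ω u : ℝ} (hu : 0 ≤ u) (huω : u ≤ ω) :
    ∫ s in (-ω)..(-u), ∫ v in (-ω)..s, Φ v = ∫ r in u..ω, (r - u) * F r := by
  have hF' : Continuous fun v => F (-v) := by fun_prop
  have e1 : ∫ s in (-ω)..(-u), ∫ v in (-ω)..s, Φ v =
      ∫ s in (-ω)..(-u), (∫ v in (-ω)..s, F (-v)) * 1 := by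
    refine intervalIntegral.integral_congr fun s hs => ?_
    rw [uIcc_of_le (by linarith)] at hs
    simp only [mul_one]
    refine intervalIntegral.integral_congr fun v hv => ?_
    rw [uIcc_of_le hs.1] at hv
    exact hΦ v (by linarith [hs.2, hv.2])
  have hd : ∀ s, HasDerivAt (fun s => ∫ v in (-ω)..s, F (-v)) (F (-s)) s := fun s =>
    intervalIntegral.integral_hasDerivAt_right (hF'.intervalIntegrable _ _)
      (hF'.stronglyMeasurableAtFilter _ _) hF'.continuousAt
  rw [e1, intervalIntegral.integral_mul_deriv_eq_deriv_mul (v := fun s => s + u)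
    (fun s _ => hd s) (fun s _ => (hasDerivAt_id s).add_const u)
    (hF'.intervalIntegrable _ _) (intervalIntegrable_const)]
  have e2 := intervalIntegral.integral_comp_neg (a := u) (b := ω)
    (fun s => F (-s) * (s + u))
  rw [← e2, neg_add_cancel, mul_zero, intervalIntegral.integral_same, zero_mul, sub_zero, zero_sub,
    ← intervalIntegral.integral_neg]
  refine intervalIntegral.integral_congr fun r _ => ?_
  simp only [neg_neg]
  ring

/-! ### The comparison function for delays at least `√2` -/

/-- The function `r_Δ(ϑ_Δ + u - Δ) χ_{[0,Δ]}(u)` of the reflected time `u = -v ≥ 0`, for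
`Δ ≥ √2`. It is a function of `u - Δ` only, and continuous. -/
noncomputable def descentRamp (Δ u : ℝ) : ℝ :=
  max 0 (1 - (max (√2 + u - Δ) 0) ^ 2 / 2)

theorem continuous_descentRamp (Δ : ℝ) : Continuous (descentRamp Δ) := by
  unfold descentRamp
  fun_prop

theorem descentRamp_nonneg (Δ u : ℝ) : 0 ≤ descentRamp Δ u := le_max_left _ _

theorem descentRamp_le_one (Δ u : ℝ) : descentRamp Δ u ≤ 1 := by
  refine max_le zero_le_one ?_
  have : 0 ≤ (max (√2 + u - Δ) 0) ^ 2 := sq_nonneg _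
  linarith

theorem descentRamp_antitone (Δ : ℝ) : Antitone (descentRamp Δ) := by
  intro u v huv
  refine max_le_max_left 0 ?_
  have h0 : 0 ≤ max (√2 + u - Δ) 0 := le_max_right _ _
  have : max (√2 + u - Δ) 0 ≤ max (√2 + v - Δ) 0 := max_le_max_right 0 (by linarith)
  have := pow_le_pow_left₀ h0 this 2
  linarith

theorem descentRamp_mono_delay {Δ Δ' : ℝ} (h : Δ ≤ Δ') (u : ℝ) :
    descentRamp Δ u ≤ descentRamp Δ' u := by
  refine max_le_max_left 0 ?_
  have h0 : 0 ≤ max (√2 + u - Δ') 0 := le_max_right _ _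
  have : max (√2 + u - Δ') 0 ≤ max (√2 + u - Δ) 0 := max_le_max_right 0 (by linarith)
  have := pow_le_pow_left₀ h0 this 2
  linarith

/-- Up to time `Δ` only the first term of the series is present. -/
theorem descent_eq_of_le {Δ t : ℝ} (hΔ : 0 ≤ Δ) (ht : t ≤ Δ) :
    descent Δ t = 1 - (max t 0) ^ 2 / 2 := by
  rw [descent, tsum_eq_single 0]
  · simp
    ring
  · intro k hk
    have hk1 : (1 : ℝ) ≤ k := by exact_mod_cast Nat.one_le_iff_ne_zero.2 hk
    rw [max_eq_right (by nlinarith), zero_pow (by omega), mul_zero]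

theorem descentZero_eq {Δ : ℝ} (hΔ : √2 ≤ Δ) : descentZero Δ = √2 := by
  have h2 : (0 : ℝ) < √2 := by positivity
  have hsq : √2 ^ 2 = (2 : ℝ) := Real.sq_sqrt (by norm_num)
  refine IsLeast.csInf_eq ⟨⟨h2, ?_⟩, ?_⟩
  · rw [descent_eq_of_le (h2.le.trans hΔ) hΔ, max_eq_left h2.le, hsq]
    norm_num
  · rintro t ⟨ht0, ht⟩
    by_contra hcon
    push Not at hcon
    rw [descent_eq_of_le (h2.le.trans hΔ) (hcon.le.trans hΔ), max_eq_left ht0.le] at ht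
    nlinarith

theorem ascentForcing_neg {Δ : ℝ} (hΔ : √2 ≤ Δ) {β : ℝ → ℝ} {u : ℝ} (hu : 0 ≤ u) :
    ascentForcing 1 Δ β (-u) = max (β (-u)) (descentRamp Δ u) := by
  have h2 : (0 : ℝ) < √2 := by positivity
  have hsq : √2 ^ 2 = (2 : ℝ) := Real.sq_sqrt (by norm_num)
  rw [ascentForcing]
  congr 1
  by_cases hu' : u ≤ Δ
  · rw [indicator_of_mem (show -u ∈ Icc (-Δ) 0 from ⟨by linarith, by linarith⟩),
      descentZero_eq hΔ, one_mul, descent_eq_of_le (h2.le.trans hΔ) (by linarith), descentRamp,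
      show √2 - -u - Δ = √2 + u - Δ by ring]
    refine (max_eq_right ?_).symm
    have h0 : 0 ≤ max (√2 + u - Δ) 0 := le_max_right _ _
    have h1 : max (√2 + u - Δ) 0 ≤ √2 := max_le (by linarith) h2.le
    nlinarith
  · push Not at hu'
    rw [indicator_of_notMem (fun h => by linarith [h.1]), descentRamp]
    refine (max_eq_left ?_).symm
    have h1 : √2 ≤ max (√2 + u - Δ) 0 := le_max_of_le_left (by linarith)
    nlinarith

/-! ### The iteration defining the ascent time -/

/-- A right-hand side on `[0, ∞)` that occurs in the iteration. -/
structure AscentAdmissible (F : ℝ → ℝ) : Prop where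
  continuous : Continuous F
  pos : ∀ u, 0 < u → 0 < F u
  le_one : ∀ u, 0 ≤ u → F u ≤ 1
  sin_le : ∀ u ∈ Icc 0 (Real.pi / 2), Real.sin u ≤ F u

/-- Comparison with the constant `1` and with the sine gives the bounds `√2` and `π / 2`. -/
theorem AscentAdmissible.existsUnique_length {F : ℝ → ℝ} (h : AscentAdmissible F) :
    ∃ ω, √2 ≤ ω ∧ ω ≤ Real.pi / 2 ∧ (∫ r in (0)..ω, r * F r = 1) ∧
      ∀ η, 0 < η → ∫ r in (0)..η, r * F r = 1 → η = ω := by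
  have h2 : (0 : ℝ) < √2 := by positivity
  have hsq : √2 ^ 2 = (2 : ℝ) := Real.sq_sqrt (by norm_num)
  have hF := h.continuous
  have hi : ∀ a b, IntervalIntegrable (fun r => r * F r) volume a b :=
    fun a b => Continuous.intervalIntegrable (by fun_prop) a b
  have hmono : ∀ a b, 0 ≤ a → a < b →
      ∫ r in (0)..a, r * F r < ∫ r in (0)..b, r * F r := by
    intro a b ha hab
    have h3 : 0 < ∫ r in a..b, r * F r :=
      intervalIntegral.intervalIntegral_pos_of_pos_on (hi _ _)
        (fun r hr => mul_pos (ha.trans_lt hr.1) (h.pos r (ha.trans_lt hr.1))) hab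
    have h4 := intervalIntegral.integral_add_adjacent_intervals (hi 0 a) (hi a b)
    linarith
  have hlow : ∫ r in (0)..√2, r * F r ≤ 1 := by
    have h3 : ∫ r in (0)..√2, r * F r ≤ ∫ r in (0)..√2, r :=
      intervalIntegral.integral_mono_on h2.le (hi _ _)
        (Continuous.intervalIntegrable (by fun_prop) _ _)
        fun r hr => mul_le_of_le_one_right hr.1 (h.le_one r hr.1)
    rw [integral_id, hsq] at h3
    linarith
  have hhigh : 1 ≤ ∫ r in (0)..(Real.pi / 2), r * F r := by
    rw [← integral_mul_sin]
    exact intervalIntegral.integral_mono_on (by positivity)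
      (Continuous.intervalIntegrable (by fun_prop) _ _) (hi _ _)
      fun r hr => mul_le_mul_of_nonneg_left (h.sin_le r hr) hr.1
  have hle : √2 ≤ Real.pi / 2 := by
    by_contra hcon
    push Not at hcon
    have := hmono _ _ (by positivity) hcon
    linarith
  obtain ⟨ω, hω, hω1⟩ := intermediate_value_Icc hle
    (intervalIntegral.continuous_primitive hi 0).continuousOn ⟨hlow, hhigh⟩
  beta_reduce at hω1
  refine ⟨ω, hω.1, hω.2, hω1, fun η hη hη1 => ?_⟩
  rcases lt_trichotomy η ω with h5 | h5 | h5
  · have := hmono _ _ hη.le h5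
    linarith
  · exact h5
  · have := hmono _ _ (h2.le.trans hω.1) h5
    linarith

/-- The length `ϖ_n`. -/
noncomputable def ascentStep (Δ : ℝ) (n : ℕ) : ℝ :=
  ascentLength 1 Δ (ascentBound 1 Δ n)

/-- The function `β_n` in the reflected time `u = -v`, for `u ≥ 0`. -/
noncomputable def ascentProfile (Δ : ℝ) : ℕ → ℝ → ℝ
  | 0 => fun _ => 1
  | n + 1 => greenIntegral (fun r => max (ascentProfile Δ n r) (descentRamp Δ r)) (ascentStep Δ n)

/-- The right-hand side `F_n` in the reflected time. -/
noncomputable def ascentSource (Δ : ℝ) (n : ℕ) (u : ℝ) : ℝ :=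
  max (ascentProfile Δ n u) (descentRamp Δ u)

theorem ascentProfile_succ (Δ : ℝ) (n : ℕ) :
    ascentProfile Δ (n + 1) = greenIntegral (ascentSource Δ n) (ascentStep Δ n) := rfl

/-- What one step of the iteration yields, for a profile that agrees with `β_n`. -/
theorem ascentStep_spec {Δ : ℝ} (hΔ : √2 ≤ Δ) {n : ℕ} (hadm : AscentAdmissible (ascentSource Δ n))
    (heq : ∀ u, 0 ≤ u → ascentBound 1 Δ n (-u) = ascentProfile Δ n u) :
    √2 ≤ ascentStep Δ n ∧ ascentStep Δ n ≤ Real.pi / 2 ∧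
      (∫ r in (0)..ascentStep Δ n, r * ascentSource Δ n r = 1) ∧
      ∀ u, 0 ≤ u → ascentBound 1 Δ (n + 1) (-u) = ascentProfile Δ (n + 1) u := by
  have h2 : (0 : ℝ) < √2 := by positivity
  have hforce : ∀ v ≤ 0, ascentForcing 1 Δ (ascentBound 1 Δ n) v = ascentSource Δ n (-v) := by
    intro v hv
    have h := ascentForcing_neg hΔ (β := ascentBound 1 Δ n) (u := -v) (by linarith)
    rw [heq (-v) (by linarith), neg_neg] at h
    exact h
  have hrefl : ∀ η u, 0 ≤ u → u ≤ η → ∫ s in (-η)..(-u), ∫ w in (-η)..s,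
      ascentForcing 1 Δ (ascentBound 1 Δ n) w = ∫ r in u..η, (r - u) * ascentSource Δ n r :=
    fun η u hu huη => integral_integral_reflect hadm.continuous hforce hu huη
  obtain ⟨ω, hω1, hω2, hω3, huniq⟩ := hadm.existsUnique_length
  have hω0 : 0 < ω := h2.trans_le hω1
  have hset : {η : ℝ | 0 < η ∧ (∫ s in (-η)..0, ∫ w in (-η)..s,
      ascentForcing 1 Δ (ascentBound 1 Δ n) w) = 1} = {ω} := by
    ext η
    simp only [mem_ofPred_eq, mem_singleton_iff]
    have h0 : ∀ η : ℝ, 0 < η → ∫ s in (-η)..0, ∫ w in (-η)..s,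
        ascentForcing 1 Δ (ascentBound 1 Δ n) w = ∫ r in (0)..η, r * ascentSource Δ n r := by
      intro η hη
      have := hrefl η 0 le_rfl hη.le
      simpa only [neg_zero, sub_zero] using this
    refine ⟨fun ⟨h3, h4⟩ => huniq η h3 ?_, fun h3 => ?_⟩
    · rw [← h0 η h3, h4]
    · subst h3
      exact ⟨hω0, (h0 η hω0).trans hω3⟩
  have hstep : ascentStep Δ n = ω := by
    rw [ascentStep, ascentLength, hset, csInf_singleton]
  refine ⟨hstep ▸ hω1, hstep ▸ hω2, hstep.symm ▸ hω3, fun u hu => ?_⟩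
  have hlen : ascentLength 1 Δ (ascentBound 1 Δ n) = ω := hstep
  rw [ascentProfile_succ, hstep]
  simp only [ascentBound, hlen]
  split_ifs with h5
  · rw [greenIntegral_of_le hω0.le (by linarith), hω3]
  · rw [greenIntegral_eq_one_sub hadm.continuous hω3 hu (by linarith),
      hrefl ω u hu (by linarith)]

theorem greenIntegral_mem_Icc {F : ℝ → ℝ} (hF : Continuous F) (hpos : ∀ u, 0 < u → 0 < F u)
    {ω : ℝ} (hω : 0 < ω) (h1 : ∫ r in (0)..ω, r * F r = 1) {u : ℝ} (hu : 0 < u) :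
    0 < greenIntegral F ω u ∧ greenIntegral F ω u ≤ 1 := by
  constructor
  · exact intervalIntegral.intervalIntegral_pos_of_pos_on
      (Continuous.intervalIntegrable (by fun_prop) _ _)
      (fun r hr => mul_pos (lt_min hr.1 hu) (hpos r hr.1)) hω
  · rw [← h1]
    refine intervalIntegral.integral_mono_on hω.le
      (Continuous.intervalIntegrable (by fun_prop) _ _)
      (Continuous.intervalIntegrable (by fun_prop) _ _) fun r hr => ?_
    rcases eq_or_lt_of_le hr.1 with h2 | h2
    · rw [← h2, min_eq_left hu.le]
    · exact mul_le_mul_of_nonneg_right (min_le_left _ _) (hpos r h2).le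

theorem greenIntegral_zero {F : ℝ → ℝ} {ω : ℝ} (hω : 0 ≤ ω) : greenIntegral F ω 0 = 0 := by
  rw [greenIntegral]
  refine (intervalIntegral.integral_congr (g := fun _ => (0 : ℝ)) fun r hr => ?_).trans (by simp)
  rw [uIcc_of_le hω] at hr
  simp only [min_eq_right hr.1, zero_mul]

theorem ascentProfile_spec {Δ : ℝ} (hΔ : √2 ≤ Δ) (n : ℕ) :
    AscentAdmissible (ascentSource Δ n) ∧ (∀ u, 0 ≤ u → 0 ≤ ascentProfile Δ n u) ∧
      ∀ u, 0 ≤ u → ascentBound 1 Δ n (-u) = ascentProfile Δ n u := by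
  induction n with
  | zero =>
    have e : ascentSource Δ 0 = fun _ => 1 := by
      funext u
      exact max_eq_left (descentRamp_le_one Δ u)
    refine ⟨?_, fun _ _ => zero_le_one, fun _ _ => rfl⟩
    rw [e]
    exact ⟨continuous_const, fun _ _ => one_pos, fun _ _ => le_rfl, fun u _ => Real.sin_le_one u⟩
  | succ n ih =>
    obtain ⟨hadm, -, heq⟩ := ih
    obtain ⟨h1, h2, h3, h4⟩ := ascentStep_spec hΔ hadm heq
    have hF := hadm.continuous
    have hω : 0 < ascentStep Δ n := lt_of_lt_of_le (by positivity) h1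
    have hcont : Continuous (ascentProfile Δ (n + 1)) := by
      obtain ⟨C, hC⟩ := (isCompact_uIcc (a := (0 : ℝ))
        (b := ascentStep Δ n)).exists_bound_of_continuousOn hF.continuousOn
      exact continuous_greenIntegral hF.measurable fun r hr => hC r (uIoc_subset_uIcc hr)
    have hmem := fun u hu => greenIntegral_mem_Icc hF hadm.pos hω h3 (u := u) hu
    rw [← ascentProfile_succ] at hmem
    have h0 : ascentProfile Δ (n + 1) 0 = 0 := greenIntegral_zero hω.le
    have hsin := greenIntegral_comparison Real.continuous_sin hF (by positivity) hω
      (fun r hr => Real.sin_nonneg_of_nonneg_of_le_pi hr.1 (by linarith [hr.2, Real.pi_pos]))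
      hadm.pos hadm.sin_le integral_mul_sin h3
    refine ⟨⟨hcont.max (continuous_descentRamp Δ), fun u hu => lt_max_of_lt_left (hmem u hu).1,
      fun u hu => max_le ?_ (descentRamp_le_one Δ u), fun u hu => le_max_of_le_left ?_⟩,
      fun u hu => ?_, h4⟩
    · rcases eq_or_lt_of_le hu with h5 | h5
      · rw [← h5, h0]
        exact zero_le_one
      · exact (hmem u h5).2
    · rw [← greenIntegral_sin hu.1 hu.2]
      exact hsin.2 u hu.1
    · rcases eq_or_lt_of_le hu with h5 | h5
      · rw [← h5, h0]
      · exact (hmem u h5).1.le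

theorem ascentStep_mem {Δ : ℝ} (hΔ : √2 ≤ Δ) (n : ℕ) :
    ascentStep Δ n ∈ Icc (√2) (Real.pi / 2) ∧
      ∫ r in (0)..ascentStep Δ n, r * ascentSource Δ n r = 1 := by
  obtain ⟨h1, -, h2⟩ := ascentProfile_spec hΔ n
  obtain ⟨h3, h4, h5, -⟩ := ascentStep_spec hΔ h1 h2
  exact ⟨⟨h3, h4⟩, h5⟩

theorem ascentStep_pos {Δ : ℝ} (hΔ : √2 ≤ Δ) (n : ℕ) : 0 < ascentStep Δ n :=
  lt_of_lt_of_le (by positivity) (ascentStep_mem hΔ n).1.1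

theorem ascentProfile_le_one {Δ : ℝ} (hΔ : √2 ≤ Δ) (n : ℕ) {u : ℝ} (hu : 0 ≤ u) :
    ascentProfile Δ n u ≤ 1 :=
  (le_max_left _ _).trans ((ascentProfile_spec hΔ n).1.le_one u hu)

/-- The comparison principle for the steps of two iterations. -/
theorem ascentStep_comparison {Δ Δ' : ℝ} (hΔ : √2 ≤ Δ) (hΔ' : √2 ≤ Δ') {m n : ℕ}
    (hle : ∀ u, 0 ≤ u → ascentSource Δ m u ≤ ascentSource Δ' n u) :
    ascentStep Δ' n ≤ ascentStep Δ m ∧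
      ∀ u, 0 ≤ u → ascentProfile Δ (m + 1) u ≤ ascentProfile Δ' (n + 1) u := by
  have h1 := (ascentProfile_spec hΔ m).1
  have h2 := (ascentProfile_spec hΔ' n).1
  exact greenIntegral_comparison h1.continuous h2.continuous (ascentStep_pos hΔ m)
    (ascentStep_pos hΔ' n)
    (fun r hr => (descentRamp_nonneg Δ r).trans (le_max_right _ _)) h2.pos
    (fun r hr => hle r hr.1) (ascentStep_mem hΔ m).2 (ascentStep_mem hΔ' n).2

theorem ascentProfile_succ_le {Δ : ℝ} (hΔ : √2 ≤ Δ) (n : ℕ) :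
    ∀ u, 0 ≤ u → ascentProfile Δ (n + 1) u ≤ ascentProfile Δ n u := by
  induction n with
  | zero => exact fun u hu => ascentProfile_le_one hΔ 1 hu
  | succ n ih =>
    exact (ascentStep_comparison hΔ hΔ fun u hu => max_le_max_right _ (ih u hu)).2

theorem ascentStep_monotone {Δ : ℝ} (hΔ : √2 ≤ Δ) : Monotone (ascentStep Δ) :=
  monotone_nat_of_le_succ fun n => (ascentStep_comparison hΔ hΔ fun u hu =>
    max_le_max_right _ (ascentProfile_succ_le hΔ n u hu)).1

theorem tendsto_ascentStep {Δ : ℝ} (hΔ : √2 ≤ Δ) :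
    Tendsto (ascentStep Δ) atTop (𝓝 (ascentTime 1 Δ)) := by
  have h : Tendsto (ascentStep Δ) atTop (𝓝 (⨆ n, ascentStep Δ n)) :=
    tendsto_atTop_ciSup (ascentStep_monotone hΔ)
      ⟨Real.pi / 2, by rintro _ ⟨n, rfl⟩; exact (ascentStep_mem hΔ n).1.2⟩
  have e : ascentTime 1 Δ = ⨆ n, ascentStep Δ n := h.limUnder_eq
  rwa [e]

/-- A longer delay gives a larger forcing, hence a shorter ascent. -/
theorem ascentTime_antitone {Δ Δ' : ℝ} (hΔ : √2 ≤ Δ) (h : Δ ≤ Δ') :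
    ascentTime 1 Δ' ≤ ascentTime 1 Δ := by
  have hΔ' := hΔ.trans h
  have hprof : ∀ n u, 0 ≤ u → ascentProfile Δ n u ≤ ascentProfile Δ' n u := by
    intro n
    induction n with
    | zero => exact fun _ _ => le_rfl
    | succ n ih =>
      exact (ascentStep_comparison hΔ hΔ' fun u hu =>
        max_le_max (ih u hu) (descentRamp_mono_delay h u)).2
  exact le_of_tendsto_of_tendsto' (tendsto_ascentStep hΔ') (tendsto_ascentStep hΔ) fun n =>
    (ascentStep_comparison hΔ hΔ' fun u hu =>
      max_le_max (hprof n u hu) (descentRamp_mono_delay h u)).1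

/-! ### The limit of the iteration -/

/-- The limit of the profiles solves the limiting boundary value problem. -/
theorem exists_limit_profile {Δ : ℝ} (hΔ : √2 ≤ Δ) :
    ∃ F : ℝ → ℝ, Continuous F ∧ (∫ r in (0)..ascentTime 1 Δ, r * F r = 1) ∧
      (∀ u, 0 ≤ u → F u = max (greenIntegral F (ascentTime 1 Δ) u) (descentRamp Δ u)) ∧
      ∀ u, 0 ≤ u → Tendsto (fun n => ascentProfile Δ n u) atTop
        (𝓝 (greenIntegral F (ascentTime 1 Δ) u)) := by
  set ω := ascentTime 1 Δ with hω
  have hstep := tendsto_ascentStep hΔ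
  rw [← hω] at hstep
  have hω2 : √2 ≤ ω := ge_of_tendsto' hstep fun n => (ascentStep_mem hΔ n).1.1
  have hω0 : 0 < ω := lt_of_lt_of_le (by positivity) hω2
  have hlim : ∀ u, ∃ l, Tendsto (fun n => (Ici (0 : ℝ)).indicator (ascentProfile Δ n) u) atTop
      (𝓝 l) := by
    intro u
    by_cases hu : u ∈ Ici (0 : ℝ)
    · simp only [indicator_of_mem hu]
      exact ⟨_, tendsto_atTop_ciInf (antitone_nat_of_succ_le fun n =>
        ascentProfile_succ_le hΔ n u hu)
        ⟨0, by rintro _ ⟨n, rfl⟩; exact (ascentProfile_spec hΔ n).2.1 u hu⟩⟩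
    · simp only [indicator_of_notMem hu]
      exact ⟨0, tendsto_const_nhds⟩
  choose b hb using hlim
  have hb' : ∀ u, 0 ≤ u → Tendsto (fun n => ascentProfile Δ n u) atTop (𝓝 (b u)) := by
    intro u hu
    have := hb u
    simpa only [indicator_of_mem (show u ∈ Ici (0 : ℝ) from hu)] using this
  have hprofmeas : ∀ n, Measurable (ascentProfile Δ n) := by
    intro n
    cases n with
    | zero => exact measurable_const
    | succ n =>
      have hF := (ascentProfile_spec hΔ n).1.continuous
      obtain ⟨C, hC⟩ := (isCompact_uIcc (a := (0 : ℝ))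
        (b := ascentStep Δ n)).exists_bound_of_continuousOn hF.continuousOn
      exact (continuous_greenIntegral hF.measurable fun r hr =>
        hC r (uIoc_subset_uIcc hr)).measurable
  have hbmeas : Measurable b := measurable_of_tendsto_metrizable
    (fun n => (hprofmeas n).indicator measurableSet_Ici) (tendsto_pi_nhds.2 hb)
  have hb1 : ∀ u, 0 ≤ u → b u ≤ 1 := fun u hu =>
    le_of_tendsto' (hb' u hu) fun n => ascentProfile_le_one hΔ n hu
  have hb0 : ∀ u, 0 ≤ u → 0 ≤ b u := fun u hu =>
    ge_of_tendsto' (hb' u hu) fun n => (ascentProfile_spec hΔ n).2.1 u hu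
  set G : ℝ → ℝ := fun u => max (b u) (descentRamp Δ u) with hG
  have hGmeas : Measurable G := hbmeas.max (continuous_descentRamp Δ).measurable
  have hG1 : ∀ u, 0 ≤ u → G u ≤ 1 := fun u hu => max_le (hb1 u hu) (descentRamp_le_one Δ u)
  have hG0 : ∀ u, 0 ≤ u → 0 ≤ G u := fun u hu => (hb0 u hu).trans (le_max_left _ _)
  have hsource : ∀ u, 0 ≤ u → Tendsto (fun n => ascentSource Δ n u) atTop (𝓝 (G u)) :=
    fun u hu => (hb' u hu).max tendsto_const_nhds
  -- integration against a weight `k` on `[0, ϖ_n]` passes to the limit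
  have hint : ∀ k : ℝ → ℝ, Continuous k → (∀ r, 0 ≤ r → |k r| ≤ r) →
      Tendsto (fun n => ∫ r in (0)..ascentStep Δ n, k r * ascentSource Δ n r) atTop
        (𝓝 (∫ r in (0)..ω, k r * G r)) := by
    intro k hk hkb
    have hcont := fun n => (ascentProfile_spec hΔ n).1.continuous
    have hle : ∀ n, ascentStep Δ n ≤ ω := fun n => (ascentStep_monotone hΔ).ge_of_tendsto hstep n
    have hbd : ∀ n r, 0 ≤ r → |k r * ascentSource Δ n r| ≤ r := by
      intro n r hr
      have h1 : 0 ≤ ascentSource Δ n r := (descentRamp_nonneg Δ r).trans (le_max_right _ _)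
      have h2 := (ascentProfile_spec hΔ n).1.le_one r hr
      rw [abs_mul, abs_of_nonneg h1]
      exact (mul_le_of_le_one_right (abs_nonneg _) h2).trans (hkb r hr)
    have h1 : Tendsto (fun n => ∫ r in (0)..ω, k r * ascentSource Δ n r) atTop
        (𝓝 (∫ r in (0)..ω, k r * G r)) := by
      refine intervalIntegral.tendsto_integral_filter_of_dominated_convergence (fun r => r)
        (Eventually.of_forall fun n => (hk.mul (hcont n)).aestronglyMeasurable)
        (Eventually.of_forall fun n => ae_of_all _ fun r hr => ?_)
        (Continuous.intervalIntegrable (by fun_prop) _ _) (ae_of_all _ fun r hr => ?_)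
      · rw [uIoc_of_le hω0.le] at hr
        exact hbd n r hr.1.le
      · rw [uIoc_of_le hω0.le] at hr
        exact (hsource r hr.1.le).const_mul _
    have h2 : Tendsto (fun n => ∫ r in ascentStep Δ n..ω, k r * ascentSource Δ n r) atTop
        (𝓝 0) := by
      refine squeeze_zero_norm (a := fun n => ω * |ω - ascentStep Δ n|) (fun n => ?_) ?_
      · refine intervalIntegral.norm_integral_le_of_norm_le_const fun r hr => ?_
        rw [uIoc_of_le (hle n)] at hr
        exact (hbd n r ((ascentStep_pos hΔ n).le.trans hr.1.le)).trans hr.2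
      · have : Tendsto (fun n => ω * |ω - ascentStep Δ n|) atTop (𝓝 (ω * |ω - ω|)) :=
          ((hstep.const_sub ω).abs).const_mul ω
        simpa using this
    have h3 := h1.sub h2
    rw [sub_zero] at h3
    refine h3.congr fun n => ?_
    have hi : ∀ a b, IntervalIntegrable (fun r => k r * ascentSource Δ n r) volume a b :=
      fun a b => (hk.mul (hcont n)).intervalIntegrable a b
    rw [← intervalIntegral.integral_add_adjacent_intervals (hi 0 (ascentStep Δ n)) (hi _ ω)]
    ring
  have hone : ∫ r in (0)..ω, r * G r = 1 := by
    refine tendsto_nhds_unique (hint (fun r => r) continuous_id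
      fun r hr => (abs_of_nonneg hr).le) ?_
    exact tendsto_const_nhds.congr fun n => (ascentStep_mem hΔ n).2.symm
  have hbgreen : ∀ u, 0 ≤ u → b u = greenIntegral G ω u := by
    intro u hu
    refine tendsto_nhds_unique ((hb' u hu).comp (tendsto_add_atTop_nat 1)) ?_
    exact hint (fun r => min r u) (by fun_prop) fun r hr => by
      rw [abs_of_nonneg (le_min hr hu)]
      exact min_le_left _ _
  have hgcont : Continuous (greenIntegral G ω) := by
    refine continuous_greenIntegral (C := 1) hGmeas fun r hr => ?_
    rw [uIoc_of_le hω0.le] at hr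
    rw [abs_of_nonneg (hG0 r hr.1.le)]
    exact hG1 r hr.1.le
  set F : ℝ → ℝ := fun u => max (greenIntegral G ω u) (descentRamp Δ u) with hF
  have hFG : ∀ u, 0 ≤ u → F u = G u := fun u hu => by
    simp only [hF, hG, hbgreen u hu]
  have hgreen : greenIntegral F ω = greenIntegral G ω := by
    funext u
    refine intervalIntegral.integral_congr fun r hr => ?_
    rw [uIcc_of_le hω0.le] at hr
    simp only [hFG r hr.1]
  refine ⟨F, hgcont.max (continuous_descentRamp Δ), ?_, fun u _ => ?_, fun u hu => ?_⟩
  · rw [← hone]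
    refine intervalIntegral.integral_congr fun r hr => ?_
    rw [uIcc_of_le hω0.le] at hr
    simp only [hFG r hr.1]
  · rw [hgreen]
  · rw [hgreen, ← hbgreen u hu]
    exact hb' u hu

/-- The boundary value problem `b'' = -max b g`, `b(0) = 0`, `b'(ω) = 0`, `b(ω) = 1` cannot have two
ordered solutions on intervals of different lengths, since the Wronskian of two such solutions is
monotone: `max b g / b` decreases in `b`. -/
theorem length_eq_of_le {F F' g : ℝ → ℝ} (hF : Continuous F) (hF' : Continuous F') {ω ω' : ℝ}
    (hω : 0 < ω) (hωω' : ω ≤ ω') (hg : ∀ u, 0 ≤ g u)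
    (h1 : ∫ r in (0)..ω, r * F r = 1)
    (hFeq : ∀ u ∈ Icc 0 ω, F u = max (greenIntegral F ω u) (g u))
    (hFeq' : ∀ u ∈ Icc 0 ω, F' u = max (greenIntegral F' ω' u) (g u))
    (hle : ∀ u ∈ Icc 0 ω, greenIntegral F' ω' u ≤ greenIntegral F ω u)
    (hpos : ∀ u, ω < u → u < ω' → 0 < F' u) : ω = ω' := by
  have hN : ∀ (H : ℝ → ℝ) (η : ℝ), Continuous H → ∀ u,
      HasDerivAt (fun u => (∫ r in (0)..u, r * H r) + u * ∫ r in u..η, H r) (∫ r in u..η, H r) u ∧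
      HasDerivAt (fun u => ∫ r in u..η, H r) (-H u) u := by
    intro H η hH u
    have hr : Continuous fun r => r * H r := by fun_prop
    have d1 : HasDerivAt (fun u => ∫ r in (0)..u, r * H r) (u * H u) u :=
      intervalIntegral.integral_hasDerivAt_right (hr.intervalIntegrable _ _)
        (hr.stronglyMeasurableAtFilter _ _) hr.continuousAt
    have d2 : HasDerivAt (fun u => ∫ r in u..η, H r) (-H u) u :=
      intervalIntegral.integral_hasDerivAt_left (hH.intervalIntegrable _ _)
        (hH.stronglyMeasurableAtFilter _ _) hH.continuousAt
    refine ⟨(d1.fun_add ((hasDerivAt_id u).fun_mul d2)).congr_deriv ?_, d2⟩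
    simp only [id]
    ring
  set N : ℝ → ℝ := fun u => (∫ r in (0)..u, r * F r) + u * ∫ r in u..ω, F r with hNdef
  set N' : ℝ → ℝ := fun u => (∫ r in (0)..u, r * F' r) + u * ∫ r in u..ω', F' r with hN'def
  have hNg : ∀ u ∈ Icc 0 ω, N u = greenIntegral F ω u := fun u hu =>
    (greenIntegral_eq hF hu.1 hu.2).symm
  have hNg' : ∀ u ∈ Icc 0 ω, N' u = greenIntegral F' ω' u := fun u hu =>
    (greenIntegral_eq hF' hu.1 (hu.2.trans hωω')).symm
  set W : ℝ → ℝ := fun u => N u * (∫ r in u..ω', F' r) - (∫ r in u..ω, F r) * N' u with hW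
  have hWd : ∀ u, HasDerivAt W (F u * N' u - N u * F' u) u := by
    intro u
    obtain ⟨a1, a2⟩ := hN F ω hF u
    obtain ⟨b1, b2⟩ := hN F' ω' hF' u
    refine ((a1.fun_mul b2).fun_sub (a2.fun_mul b1)).congr_deriv ?_
    simp only [hNdef, hN'def]
    ring
  have hanti : AntitoneOn W (Icc 0 ω) := by
    refine antitoneOn_of_deriv_nonpos (convex_Icc _ _)
      (fun u _ => (hWd u).continuousAt.continuousWithinAt)
      (fun u _ => (hWd u).differentiableAt.differentiableWithinAt) fun u hu => ?_
    have hu' := interior_subset hu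
    rw [(hWd u).deriv, hFeq u hu', hFeq' u hu', ← hNg u hu', ← hNg' u hu']
    have h2 : N' u ≤ N u := by
      rw [hNg u hu', hNg' u hu']
      exact hle u hu'
    have h3 := mul_le_mul_of_nonneg_left h2 (hg u)
    rcases le_total (N u) (g u) with h4 | h4
    · rw [max_eq_right h4, max_eq_right (h2.trans h4)]
      linarith
    · rw [max_eq_left h4]
      have h5 : N u * N' u ≤ N u * max (N' u) (g u) :=
        mul_le_mul_of_nonneg_left (le_max_left _ _) ((hg u).trans h4)
      linarith
  have h0 : W 0 = 0 := by simp [hW, hNdef, hN'def]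
  have hωW : W ω = ∫ r in ω..ω', F' r := by
    simp [hW, hNdef, h1]
  have h5 := hanti (left_mem_Icc.2 hω.le) (right_mem_Icc.2 hω.le) hω.le
  rw [h0, hωW] at h5
  by_contra hne
  have hlt := lt_of_le_of_ne hωω' hne
  have := intervalIntegral.intervalIntegral_pos_of_pos_on (hF'.intervalIntegrable _ _)
    (fun r hr => hpos r hr.1 hr.2) hlt
  linarith

/-! ### The critical delay -/

/-- In the time `t = γ - u` the limiting problem with `Δ = ω = γ` does not depend on `γ`. Its
solution starts as `cos t` until it meets the increasing function `r_Δ(√2 - t)`, so that its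
right-hand side is the maximum of these two functions. -/
noncomputable def criticalSource (t : ℝ) : ℝ :=
  max (Real.cos t) (1 - (max (√2 - t) 0) ^ 2 / 2)

theorem continuous_criticalSource : Continuous criticalSource := by
  unfold criticalSource
  fun_prop

theorem exists_criticalDelay : ∃ γ ∈ Icc (√2) (Real.pi / 2),
    ∫ r in (0)..γ, r * criticalSource (γ - r) = 1 := by
  have hc := continuous_criticalSource
  have hcont : Continuous fun T => ∫ r in (0)..T, r * criticalSource (T - r) := by
    have e : (fun T => ∫ r in (0)..T, r * criticalSource (T - r)) = fun T =>
        T * (∫ r in (0)..T, criticalSource r) - ∫ r in (0)..T, r * criticalSource r := by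
      funext T
      have h := intervalIntegral.integral_comp_sub_left (a := 0) (b := T)
        (fun r => (T - r) * criticalSource r) T
      simp only [sub_sub_cancel, sub_self, sub_zero] at h
      rw [h, ← intervalIntegral.integral_const_mul, ← intervalIntegral.integral_sub
        (Continuous.intervalIntegrable (by fun_prop) _ _)
        (Continuous.intervalIntegrable (by fun_prop) _ _)]
      refine intervalIntegral.integral_congr fun r _ => ?_
      ring
    rw [e]
    have h1 := intervalIntegral.continuous_primitive
      (fun a b => hc.intervalIntegrable (μ := volume) a b) 0
    have h2 := intervalIntegral.continuous_primitive
      (fun a b => (continuous_id.mul hc).intervalIntegrable (μ := volume) a b) 0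
    exact (continuous_id.mul h1).sub h2
  have h2 : (0 : ℝ) < √2 := by positivity
  have hsq : √2 ^ 2 = (2 : ℝ) := Real.sq_sqrt (by norm_num)
  have hlow : ∫ r in (0)..√2, r * criticalSource (√2 - r) ≤ 1 := by
    have h3 : ∫ r in (0)..√2, r * criticalSource (√2 - r) ≤ ∫ r in (0)..√2, r := by
      refine intervalIntegral.integral_mono_on h2.le
        (Continuous.intervalIntegrable (by fun_prop) _ _)
        (Continuous.intervalIntegrable (by fun_prop) _ _) fun r hr => ?_
      refine mul_le_of_le_one_right hr.1 (max_le (Real.cos_le_one _) ?_)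
      have : 0 ≤ (max (√2 - (√2 - r)) 0) ^ 2 := sq_nonneg _
      linarith
    rw [integral_id, hsq] at h3
    linarith
  have hhigh : 1 ≤ ∫ r in (0)..(Real.pi / 2), r * criticalSource (Real.pi / 2 - r) := by
    have h3 := integral_sub_mul_cos 0 (Real.pi / 2)
    simp only [sub_zero, Real.cos_pi_div_two] at h3
    rw [← h3]
    exact intervalIntegral.integral_mono_on (by positivity)
      (Continuous.intervalIntegrable (by fun_prop) _ _)
      (Continuous.intervalIntegrable (by fun_prop) _ _)
      fun r hr => mul_le_mul_of_nonneg_left (le_max_left _ _) hr.1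
  have hle : √2 ≤ Real.pi / 2 := by
    have h3 : √2 ≤ 3 / 2 := Real.sqrt_le_iff.2 (by norm_num)
    linarith [Real.pi_gt_three]
  exact intermediate_value_Icc hle hcont.continuousOn ⟨hlow, hhigh⟩

/-- The solution with right-hand side `criticalSource` solves the limiting problem. -/
theorem criticalSource_eq {γ : ℝ} (hγ : γ ∈ Icc (√2) (Real.pi / 2))
    (h1 : ∫ r in (0)..γ, r * criticalSource (γ - r) = 1) {u : ℝ} (hu : u ∈ Icc 0 γ) :
    criticalSource (γ - u) =
      max (greenIntegral (fun r => criticalSource (γ - r)) γ u) (descentRamp γ u) := by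
  have hc := continuous_criticalSource
  have hF : Continuous fun r => criticalSource (γ - r) := by fun_prop
  have hsq : √2 ^ 2 = (2 : ℝ) := Real.sq_sqrt (by norm_num)
  have hramp : ∀ r ∈ Icc 0 γ, 1 - (max (√2 - (γ - r)) 0) ^ 2 / 2 = descentRamp γ r := by
    intro r hr
    rw [descentRamp, show √2 - (γ - r) = √2 + r - γ by ring]
    refine (max_eq_right ?_).symm
    have h3 : max (√2 + r - γ) 0 ≤ √2 := max_le (by linarith [hr.2]) (by positivity)
    have h4 : 0 ≤ max (√2 + r - γ) 0 := le_max_right _ _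
    nlinarith
  have hsource : ∀ r ∈ Icc 0 γ,
      criticalSource (γ - r) = max (Real.cos (γ - r)) (descentRamp γ r) := fun r hr => by
    rw [criticalSource, hramp r hr]
  have hgreen := greenIntegral_eq_one_sub hF h1 hu.1 hu.2
  have hcos := integral_sub_mul_cos u γ
  have hgle : greenIntegral (fun r => criticalSource (γ - r)) γ u ≤ Real.cos (γ - u) := by
    have h5 : ∫ r in u..γ, (r - u) * Real.cos (γ - r) ≤
        ∫ r in u..γ, (r - u) * criticalSource (γ - r) :=
      intervalIntegral.integral_mono_on hu.2
        (Continuous.intervalIntegrable (by fun_prop) _ _)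
        (Continuous.intervalIntegrable (by fun_prop) _ _)
        fun r hr => mul_le_mul_of_nonneg_left (le_max_left _ _) (by linarith [hr.1])
    linarith
  rw [hsource u hu]
  rcases le_total (Real.cos (γ - u)) (descentRamp γ u) with h6 | h6
  · rw [max_eq_right h6, max_eq_right (hgle.trans h6)]
  · -- the cosine dominates on all of `[u, γ]`, so the Green integral is that of the cosine
    have h7 : ∫ r in u..γ, (r - u) * criticalSource (γ - r) =
        ∫ r in u..γ, (r - u) * Real.cos (γ - r) := by
      refine intervalIntegral.integral_congr fun r hr => ?_
      rw [uIcc_of_le hu.2] at hr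
      have h8 : Real.cos (γ - u) ≤ Real.cos (γ - r) :=
        Real.cos_le_cos_of_nonneg_of_le_pi (by linarith [hr.2])
          (by linarith [hu.1, hγ.2, Real.pi_pos]) (by linarith [hr.1])
      simp only [hsource r ⟨hu.1.trans hr.1, hr.2⟩,
        max_eq_left ((descentRamp_antitone γ hr.1).trans (h6.trans h8))]
    have h9 : greenIntegral (fun r => criticalSource (γ - r)) γ u = Real.cos (γ - u) := by
      linarith
    rw [h9]

/-- The solution with right-hand side `criticalSource` is below all profiles, hence below their
limit, and `length_eq_of_le` applies to it and this limit. -/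
theorem ascentTime_criticalDelay {γ : ℝ} (hγ : γ ∈ Icc (√2) (Real.pi / 2))
    (h1 : ∫ r in (0)..γ, r * criticalSource (γ - r) = 1) : ascentTime 1 γ = γ := by
  have hc := continuous_criticalSource
  set F' : ℝ → ℝ := fun r => criticalSource (γ - r) with hF'def
  have hF' : Continuous F' := by fun_prop
  have hγ0 : 0 < γ := lt_of_lt_of_le (by positivity) hγ.1
  have hcos : ∀ r, 0 < r → r ≤ γ → 0 < F' r := fun r hr hrγ =>
    lt_max_of_lt_left (Real.cos_pos_of_mem_Ioo
      ⟨by linarith [Real.pi_pos], by linarith [hγ.2]⟩)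
  have hF'0 : ∀ r ∈ Icc 0 γ, 0 ≤ F' r := fun r hr => by
    refine (Real.cos_nonneg_of_neg_pi_div_two_le_of_le ?_ ?_).trans (le_max_left _ _)
    · linarith [Real.pi_pos, hr.2]
    · linarith [hγ.2, hr.1]
  have hgreen1 : ∀ u, greenIntegral F' γ u ≤ 1 := fun u => by
    rw [← h1]
    refine intervalIntegral.integral_mono_on hγ0.le
      (Continuous.intervalIntegrable (by fun_prop) _ _)
      (Continuous.intervalIntegrable (by fun_prop) _ _) fun r hr => ?_
    exact mul_le_mul_of_nonneg_right (min_le_left _ _) (hF'0 r hr)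
  have hcompare : ∀ n, (∀ u, 0 ≤ u → greenIntegral F' γ u ≤ ascentProfile γ n u) →
      ascentStep γ n ≤ γ ∧ ∀ u, 0 ≤ u → greenIntegral F' γ u ≤ ascentProfile γ (n + 1) u := by
    intro n hn
    have hadm := (ascentProfile_spec hγ.1 n).1
    refine greenIntegral_comparison hF' hadm.continuous hγ0 (ascentStep_pos hγ.1 n) hF'0 hadm.pos
      (fun r hr => ?_) h1 (ascentStep_mem hγ.1 n).2
    rw [show F' r = _ from criticalSource_eq hγ h1 hr]
    exact max_le_max_right _ (hn r hr.1)
  have hprof : ∀ n u, 0 ≤ u → greenIntegral F' γ u ≤ ascentProfile γ n u := by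
    intro n
    induction n with
    | zero => exact fun u _ => hgreen1 u
    | succ n ih => exact (hcompare n ih).2
  have hstep := tendsto_ascentStep hγ.1
  have hle : ascentTime 1 γ ≤ γ := le_of_tendsto' hstep fun n => (hcompare n (hprof n)).1
  have hpos : 0 < ascentTime 1 γ :=
    lt_of_lt_of_le (by positivity) (ge_of_tendsto' hstep fun n => (ascentStep_mem hγ.1 n).1.1)
  obtain ⟨F, hF, hF1, hFeq, hFlim⟩ := exists_limit_profile hγ.1
  exact length_eq_of_le hF hF' hpos hle (descentRamp_nonneg γ) hF1 (fun u hu => hFeq u hu.1)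
    (fun u hu => criticalSource_eq hγ h1 ⟨hu.1, hu.2.trans hle⟩)
    (fun u hu => ge_of_tendsto' (hFlim u hu.1) fun n => hprof n u hu.1)
    (fun u hu hu' => hcos u (hpos.trans hu) hu'.le)

theorem existsUnique_ascentTime_eq :
    ∃! γ : ℝ, γ ∈ Icc (Real.sqrt 2) (Real.pi / 2) ∧ ascentTime 1 γ = γ := by
  obtain ⟨γ, hγ, h1⟩ := exists_criticalDelay
  have key : ∀ a b : ℝ, √2 ≤ a → a < b → ascentTime 1 a = a → ascentTime 1 b = b → False := by
    intro a b ha hab h2 h3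
    have := ascentTime_antitone ha hab.le
    linarith
  refine ⟨γ, ⟨hγ, ascentTime_criticalDelay hγ h1⟩, fun η hη => ?_⟩
  have h2 := ascentTime_criticalDelay hγ h1
  rcases lt_trichotomy η γ with h | h | h
  · exact (key η γ hη.1.1 h hη.2 h2).elim
  · exact h
  · exact (key γ η hγ.1 h h2 hη.2).elim

/-! ### Delay equations with nonpositive coefficient -/

theorem AbsolutelyContinuousOnInterval.congr {f g : ℝ → ℝ} {a b : ℝ}
    (hf : AbsolutelyContinuousOnInterval f a b) (h : EqOn f g (uIcc a b)) :
    AbsolutelyContinuousOnInterval g a b := by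
  rw [absolutelyContinuousOnInterval_iff] at hf ⊢
  intro ε hε
  obtain ⟨δ, hδ, hE⟩ := hf ε hε
  refine ⟨δ, hδ, fun E hEm hEδ => ?_⟩
  refine lt_of_eq_of_lt (Finset.sum_congr rfl fun i hi => ?_) (hE E hEm hEδ)
  rw [h (hEm.1 i hi).1, h (hEm.1 i hi).2]

theorem ae_le_maxDelay {τ : ℝ → ℝ} (hτ : ∃ C : ℝ, ∀ᵐ t, τ t ≤ C) (s : ℝ) :
    ∀ᵐ t, s ≤ t → τ t ≤ maxDelay τ s := by
  obtain ⟨C, hC⟩ := hτ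
  have h : ∀ᵐ t ∂(volume.restrict (Ici s)), τ t ≤ maxDelay τ s :=
    ae_le_essSup ⟨C, eventually_map.2 (ae_restrict_of_ae hC)⟩
  exact (ae_restrict_iff' measurableSet_Ici).1 h

theorem maxDelay_nonneg {τ : ℝ → ℝ} (hτ : ∃ C : ℝ, ∀ᵐ t, τ t ≤ C) (h0 : ∀ t, 0 ≤ τ t) (s : ℝ) :
    0 ≤ maxDelay τ s := by
  have h := (ae_restrict_iff' measurableSet_Ici).2 (ae_le_maxDelay hτ s)
  have hne : (ae (volume.restrict (Ici s))).NeBot := by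
    rw [ae_neBot, Ne, Measure.restrict_eq_zero]
    simp
  obtain ⟨t, ht⟩ := h.exists
  exact (h0 t).trans ht

theorem ae_abs_le_essSup {p : ℝ → ℝ} (hp : ∃ C : ℝ, ∀ᵐ t, |p t| ≤ C) :
    ∀ᵐ t, |p t| ≤ essSup (fun t => |p t|) volume := by
  obtain ⟨C, hC⟩ := hp
  exact ae_le_essSup ⟨C, eventually_map.2 hC⟩

theorem lintegral_Ioi_eq_top {p : ℝ → ℝ} {P : ℝ} (hP : ∀ᵐ t, |p t| ≤ P)
    (hint : (∫⁻ t in Ici (0 : ℝ), ENNReal.ofReal |p t|) = ⊤) (T : ℝ) :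
    ∫⁻ t in Ioi T, ENNReal.ofReal |p t| = ⊤ := by
  have hsub : Ici (0 : ℝ) ⊆ Icc 0 T ∪ Ioi T := fun t ht => by
    rcases le_or_gt t T with h | h
    · exact Or.inl ⟨ht, h⟩
    · exact Or.inr h
  have h1 : (⊤ : ENNReal) ≤ (∫⁻ t in Icc 0 T, ENNReal.ofReal |p t|) +
      ∫⁻ t in Ioi T, ENNReal.ofReal |p t| := by
    rw [← hint]
    exact (lintegral_mono_set hsub).trans (lintegral_union_le _ _ _)
  have h2 : ∫⁻ t in Icc 0 T, ENNReal.ofReal |p t| < ⊤ := by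
    calc ∫⁻ t in Icc 0 T, ENNReal.ofReal |p t| ≤ ∫⁻ _ in Icc 0 T, ENNReal.ofReal P := by
          refine lintegral_mono_ae (ae_restrict_of_ae ?_)
          filter_upwards [hP] with t ht using ENNReal.ofReal_le_ofReal ht
      _ < ⊤ := by
          rw [lintegral_const]
          exact ENNReal.mul_lt_top ENNReal.ofReal_lt_top (by simp)
  rcases ENNReal.add_eq_top.1 (top_le_iff.1 h1) with h3 | h3
  · exact absurd h3 h2.ne
  · exact h3

theorem essSup_abs_pos {p : ℝ → ℝ} (hp : ∃ C : ℝ, ∀ᵐ t, |p t| ≤ C)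
    (hint : (∫⁻ t in Ici (0 : ℝ), ENNReal.ofReal |p t|) = ⊤) :
    0 < essSup (fun t => |p t|) volume := by
  by_contra hcon
  push Not at hcon
  have h : ∫⁻ t in Ici (0 : ℝ), ENNReal.ofReal |p t| = ∫⁻ t in Ici (0 : ℝ), 0 := by
    refine lintegral_congr_ae (ae_restrict_of_ae ?_)
    filter_upwards [ae_abs_le_essSup hp] with t ht
    exact ENNReal.ofReal_of_nonpos (ht.trans hcon)
  rw [h, lintegral_zero] at hint
  exact ENNReal.zero_ne_top hint

theorem IsDelaySolution.positiveFeedback {p τ x : ℝ → ℝ} {s P : ℝ} (h : IsDelaySolution p τ s x)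
    (hP : ∀ᵐ t, |p t| ≤ P) (hτ : ∃ C : ℝ, ∀ᵐ t, τ t ≤ C) (hτ0 : ∀ t, 0 ≤ τ t)
    (hp0 : ∀ t, p t ≤ 0) : PositiveFeedback (fun t => -p t) τ s (maxDelay τ s) P x := by
  have hD := maxDelay_nonneg hτ hτ0 s
  refine ⟨fun t ht => ?_, fun a b ha hab => ?_, ?_, fun t => neg_nonneg.2 (hp0 t), ?_, hτ0, ?_⟩
  · exact ((h.differentiableOn t (mem_Ici.2 (by linarith))).differentiableAt
      (Ici_mem_nhds (by linarith))).hasDerivAt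
  · refine ((h.absCont_deriv b (by linarith)).mono ?_).congr fun t ht => ?_
    · rw [uIcc_of_le hab, uIcc_of_le (by linarith)]
      exact Icc_subset_Icc (by linarith) le_rfl
    · rw [uIcc_of_le hab] at ht
      exact derivWithin_of_mem_nhds (Ici_mem_nhds (by linarith [ht.1]))
  · filter_upwards [(ae_restrict_iff' measurableSet_Ici).1 h.equation] with t ht hst
    refine (ht (mem_Ici.2 hst.le)).congr_deriv ?_
    ring
  · filter_upwards [hP] with t ht using (neg_le_abs _).trans ht
  · filter_upwards [ae_le_maxDelay hτ s] with t ht hst using ht hst.le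

/-- The largest value of `ν² exp (-ν D)` is `(2 / (e D))²`, attained at `ν = 2 / D`. -/
theorem exists_decay_rate {D P : ℝ} (hP : 0 < P) (hD : 0 ≤ D) (h : D * √P ≤ 2 / Real.exp 1) :
    ∃ ν, 0 < ν ∧ P * Real.exp (ν * D) ≤ ν ^ 2 := by
  rcases eq_or_lt_of_le hD with h0 | h0
  · refine ⟨√P, Real.sqrt_pos.2 hP, ?_⟩
    rw [← h0, mul_zero, Real.exp_zero, mul_one, Real.sq_sqrt hP.le]
  · refine ⟨2 / D, by positivity, ?_⟩
    rw [div_mul_cancel₀ _ h0.ne', show (2 : ℝ) = 1 + 1 by norm_num, Real.exp_add]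
    rw [le_div_iff₀ (Real.exp_pos 1)] at h
    have h2 : (√P * Real.exp 1) ≤ 2 / D := by
      rw [le_div_iff₀ h0]
      linarith
    calc P * (Real.exp 1 * Real.exp 1) = (√P * Real.exp 1) ^ 2 := by
          rw [mul_pow, Real.sq_sqrt hP.le]
          ring
      _ ≤ (2 / D) ^ 2 := by gcongr
      _ = ((1 + 1) / D) ^ 2 := by norm_num

/-- The equation is started at `s - D` with coefficient zero up to time `s`, so that the history on
`[s - D, s]` is constructed together with the solution. -/
theorem exists_positive_bounded_solution {p τ : ℝ → ℝ} (hpm : AEMeasurable p)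
    (hτm : AEMeasurable τ) {P : ℝ} (hP0 : 0 < P) (hP : ∀ᵐ t, |p t| ≤ P)
    (hτ : ∃ C : ℝ, ∀ᵐ t, τ t ≤ C) (hτ0 : ∀ t, 0 ≤ τ t) (hp0 : ∀ t, p t ≤ 0) {s : ℝ}
    (h : maxDelay τ s * √P ≤ 2 / Real.exp 1) :
    ∃ x : ℝ → ℝ, IsDelaySolution p τ s x ∧ ∀ t, s ≤ t → 0 < x t ∧ x t ≤ 1 := by
  have hD := maxDelay_nonneg hτ hτ0 s
  set D := maxDelay τ s with hDdef
  obtain ⟨ν, hν, hνP⟩ := exists_decay_rate hP0 hD h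
  -- measurable versions of the coefficient and of the delay that obey the bounds everywhere
  set q : ℝ → ℝ := fun t => min P (max 0 (-hpm.mk p t)) with hq
  set σ : ℝ → ℝ := fun t => min D (max 0 (hτm.mk τ t)) with hσ
  have hqm : Measurable q := measurable_const.min (measurable_const.max hpm.measurable_mk.neg)
  have hσm : Measurable σ := measurable_const.min (measurable_const.max hτm.measurable_mk)
  have hq0 : ∀ t, 0 ≤ q t := fun t => le_min hP0.le (le_max_left _ _)
  have hσ0 : ∀ t, 0 ≤ σ t := fun t => le_min hD (le_max_left _ _)
  have hσD : ∀ t, σ t ≤ D := fun t => min_le_left _ _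
  have hdata : DecayData ν (s - D) D ((Ici s).indicator fun t => q t * Real.exp (ν * σ t)) σ := by
    refine ⟨hν, Measurable.indicator (by fun_prop) measurableSet_Ici, hσm,
      fun t => indicator_nonneg (fun r _ => mul_nonneg (hq0 r) (Real.exp_pos _).le) t,
      fun t => ?_, fun t ht => ?_, hσ0, hσD⟩
    · refine indicator_le' (fun r _ => ?_) (fun r _ => sq_nonneg ν) t
      refine le_trans ?_ hνP
      exact mul_le_mul (min_le_left _ _)
        (Real.exp_le_exp.2 (mul_le_mul_of_nonneg_left (hσD r) hν.le)) (Real.exp_pos _).le hP0.le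
    · exact indicator_of_notMem (fun h1 => by linarith [mem_Ici.1 h1]) _
  obtain ⟨x, hxd, hxac, hxac', hxeq, hxpos⟩ := hdata.exists_solution
  refine ⟨x, ⟨hxd.differentiableOn, fun b _ => hxac _ b, fun b hb => ?_, ?_⟩,
    fun t ht => hxpos t (by linarith)⟩
  · refine (hxac' (s - D) b).congr fun t ht => ?_
    rw [uIcc_of_le hb] at ht
    exact ((hxd t).derivWithin (uniqueDiffOn_Ici _ t ht.1)).symm
  · rw [ae_restrict_iff' measurableSet_Ici]
    filter_upwards [hxeq, hpm.ae_eq_mk, hτm.ae_eq_mk, hP, ae_le_maxDelay hτ s]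
      with t h1 h2 h3 h4 h5 hst
    have hst : s ≤ t := hst
    refine (h1 (by linarith)).congr_deriv ?_
    have eq1 : q t = -p t := by
      simp only [hq]
      rw [← h2, max_eq_right (neg_nonneg.2 (hp0 t)), min_eq_right ((neg_le_abs _).trans h4)]
    have eq2 : σ t = τ t := by
      simp only [hσ]
      rw [← h3, max_eq_right (hτ0 t), min_eq_right (h5 hst)]
    rw [indicator_of_mem (show t ∈ Ici s from hst), eq1, eq2, mul_assoc (-p t), ← Real.exp_add,
      neg_mul ν, add_neg_cancel, Real.exp_zero]
    ring

theorem mainTheorem3 :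
    (∃! γ : ℝ, γ ∈ Icc (Real.sqrt 2) (Real.pi / 2) ∧ ascentTime 1 γ = γ) ∧
    ∀ γ : ℝ, γ ∈ Icc (Real.sqrt 2) (Real.pi / 2) → ascentTime 1 γ = γ →
    ∀ p τ : ℝ → ℝ, AEMeasurable p volume → AEMeasurable τ volume →
      (∃ C : ℝ, ∀ᵐ t, |p t| ≤ C) → (∃ C : ℝ, ∀ᵐ t, τ t ≤ C) →
      (∀ t, 0 ≤ τ t) → (∀ t, p t ≤ 0) →
      (∫⁻ t in Ici (0 : ℝ), ENNReal.ofReal |p t|) = ⊤ →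
    ∀ s : ℝ, maxDelay τ s * Real.sqrt (essSup (fun t => |p t|) volume) < γ →
      (∀ x : ℝ → ℝ, IsDelaySolution p τ s x → ∃! k : AsymptoticBehavior, k.Holds x) ∧
      (maxDelay τ s * Real.sqrt (essSup (fun t => |p t|) volume) ≤ 2 / Real.exp 1 →
        ∃ x : ℝ → ℝ, IsDelaySolution p τ s x ∧ AsymptoticBehavior.monotoneDecay.Holds x) := by
  refine ⟨existsUnique_ascentTime_eq, ?_⟩
  intro γ hγ _ p τ hpm hτm hpb hτb hτ0 hp0 hint s hs
  set P := essSup (fun t => |p t|) volume with hPdef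
  have hP : ∀ᵐ t, |p t| ≤ P := ae_abs_le_essSup hpb
  have hP0 : 0 < P := essSup_abs_pos hpb hint
  have hD := maxDelay_nonneg hτb hτ0 s
  have hint' : ∀ T, ∫⁻ t in Ioi T, ENNReal.ofReal (-p t) = ⊤ := fun T => by
    have := lintegral_Ioi_eq_top hP hint T
    simpa only [abs_of_nonpos (hp0 _)] using this
  have hex : ∀ x : ℝ → ℝ, IsDelaySolution p τ s x → ∃ k : AsymptoticBehavior, k.Holds x :=
    fun x hx => (hx.positiveFeedback hP hτb hτ0 hp0).exists_asymptoticBehavior hpm.neg hint' hP0 hD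
      (hs.le.trans hγ.2)
  refine ⟨fun x hx => ?_, fun h2e => ?_⟩
  · obtain ⟨k, hk⟩ := hex x hx
    exact ⟨k, hk, fun l hl => hl.unique hk⟩
  · obtain ⟨x, hx, hpos⟩ := exists_positive_bounded_solution hpm hτm hP0 hP hτb hτ0 hp0 h2e
    refine ⟨x, hx, ?_⟩
    obtain ⟨k, hk⟩ := hex x hx
    -- a solution with values in `(0, 1]` can only have the second behaviour
    cases k with
    | monotoneDecay => exact hk
    | oscillatoryDecay =>
      obtain ⟨t, ht, ht0⟩ := hk.1 s
      exact absurd ht0 (hpos t ht).1.ne'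
    | toPosInfinity =>
      obtain ⟨t, ht1, ht2⟩ := ((hk.1.eventually_gt_atTop 1).and (eventually_ge_atTop s)).exists
      exact absurd ht1 (not_lt.2 (hpos t ht2).2)
    | toNegInfinity =>
      obtain ⟨t, ht1, ht2⟩ := ((hk.1.eventually_lt_atBot 0).and (eventually_ge_atTop s)).exists
      exact absurd ht1 (not_lt.2 (hpos t ht2).1.le)
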